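/- Let $\times$ be the octonionic cross product on $\mathbb R^7$ (for which the standard basis satisfies $e_1\times e_2=e_3$, $e_1\times e_4=e_5$, $e_2\times e_4=e_6$, $e_3\times e_4=e_7$, \dots), extended $\mathbb C$-bilinearly to $\mathbb C^7$. Let $S$ be a connected Riemann surface and $f:S\to S^6\subset\mathbb R^7$ an almost complex curve, i.e. a smooth map with $\partial_y f=f\times\partial_x f$ in every local complex coordinate $z=x+iy$. Suppose that $[f]:S\to\mathbb CP^6$ is linearly full (its image lies in no proper projective subspace) and superminimal (its harmonic sequence terminates at both ends, where the successor $\partial\psi$ of a harmonic map $\psi$ with line bundle $L\subset S\times\mathbb C^7$ is spanned, off isolated zeros, by the sections $(\partial s/\partial z)^{L^\perp}$ with $s$ a section of $L$, extended smoothly over these zeros, and the predecessor likewise by $(\partial s/\partial\bar z)^{L^\perp}$). Then the harmonic sequence of $[f]$ has the form $(\psi_j)_{j=0}^6$ with $\psi_3=[f]$, where $\psi_0$ is holomorphic and $\psi_6$ antiholomorphic. In a local complex coordinate $z$, let $f_0,\dots,f_6$, with $f_3=f$, be the meromorphic local sections of the line bundles of $\psi_0,\dots,\psi_6$ (i.e.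 locally $(z-z_0)^k$, $k\in\mathbb Z$, times a nowhere vanishing section $g$ of the line bundle $L$ with $(\partial g/\partial\bar z)^{L}=0$) that are characterized by $$\frac{\partial f_p}{\partial z}=f_{p+1}+\frac{\langle \partial f_p/\partial z,\,f_p\rangle}{|f_p|^2}f_p,\qquad \frac{\partial f_{p+1}}{\partial\bar z}=-\frac{|f_{p+1}|^2}{|f_p|^2}f_p\qquad(0\le p\le 5),$$ where $\langle\cdot,\cdot\rangle$ is the standard Hermitian product, linear in its first argument. Then, as identities of meromorphic sections (i.e. off a discrete subset of the coordinate domain), the products $f_i\times f_j$ (row $i$, column $j$) are $$\begin{array}{|c||c|c|c|c|c|c|c|}\hline i\backslash j&0&1&2&3&4&5&6\\ \hline\hline 0&0&0&0&-if_0&-2if_1&-2if_2&-if_3\\ \hline 1&0&0&if_0&if_1&0&-if_3&-if_4\\ \hline 2&0&-if_0&0&if_2&if_3&0&-if_5\\ \hline 3&if_0&-if_1&-if_2&0&if_4&if_5&-if_6\\ \hline 4&2if_1&0&-if_3&-if_4&0&2if_6&0\\ \hline 5&2if_2&if_3&0&-if_5&-2if_6&0&0\\ \hline 6&if_3&if_4&if_5&if_6&0&0&0\\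 \hline\end{array}$$ and moreover $|f_4|^2|f_5|^2=2|f_6|^2$. -/

import Mathlib

open scoped Manifold ContDiff LinearAlgebra.Projectivization

noncomputable section

/-! ### The cross product of `ℝ⁷` and the sphere `S⁶` -/

/-- The octonionic cross product on `𝕜⁷`, for which the standard basis is a `G₂`-basis:
`e₁ × e₂ = e₃`, `e₁ × e₄ = e₅`, `e₂ × e₄ = e₆`, `e₃ × e₄ = e₇`, and so on (the index `i : Fin 7`
stands for `e_{i+1}`). For `𝕜 = ℝ` it is the cross product of `ℝ⁷`, for `𝕜 = ℂ` its
`ℂ`-bilinear extension to `ℂ⁷`. -/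
def cross {𝕜 : Type*} [RCLike 𝕜] (x y : EuclideanSpace 𝕜 (Fin 7)) : EuclideanSpace 𝕜 (Fin 7) :=
  !₂[(x 1 * y 2 - x 2 * y 1) + (x 3 * y 4 - x 4 * y 3) + (x 6 * y 5 - x 5 * y 6),
     (x 2 * y 0 - x 0 * y 2) + (x 3 * y 5 - x 5 * y 3) + (x 4 * y 6 - x 6 * y 4),
     (x 0 * y 1 - x 1 * y 0) + (x 3 * y 6 - x 6 * y 3) + (x 5 * y 4 - x 4 * y 5),
     (x 4 * y 0 - x 0 * y 4) + (x 5 * y 1 - x 1 * y 5) + (x 6 * y 2 - x 2 * y 6),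
     (x 0 * y 3 - x 3 * y 0) + (x 6 * y 1 - x 1 * y 6) + (x 2 * y 5 - x 5 * y 2),
     (x 1 * y 3 - x 3 * y 1) + (x 0 * y 6 - x 6 * y 0) + (x 4 * y 2 - x 2 * y 4),
     (x 2 * y 3 - x 3 * y 2) + (x 5 * y 0 - x 0 * y 5) + (x 1 * y 4 - x 4 * y 1)]

instance factFinrankSeven : Fact (Module.finrank ℝ (EuclideanSpace ℝ (Fin 7)) = 6 + 1) :=
  ⟨by simp⟩

/-- The unit sphere `S⁶ ⊆ ℝ⁷`, with its standard smooth structure. -/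
abbrev SphereSix : Type := Metric.sphere (0 : EuclideanSpace ℝ (Fin 7)) 1

/-- The inclusion `ℝ⁷ ⊆ ℂ⁷`. -/
def complexify (x : EuclideanSpace ℝ (Fin 7)) : EuclideanSpace ℂ (Fin 7) :=
  WithLp.toLp 2 (fun i => (x i : ℂ))

theorem complexify_ne_zero (x : SphereSix) :
    complexify (x : EuclideanSpace ℝ (Fin 7)) ≠ 0 := by
  intro h
  have hx : (x : EuclideanSpace ℝ (Fin 7)) = 0 := by
    ext i
    have hi := congrArg (fun v : EuclideanSpace ℂ (Fin 7) => v i) h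
    simpa [complexify] using hi
  have h1 : ‖(x : EuclideanSpace ℝ (Fin 7))‖ = 1 := by simp
  rw [hx, norm_zero] at h1
  exact zero_ne_one h1

/-- The map `[f] : S → ℂP⁶` defined by `f : S → S⁶`. -/
def projMap {S : Type*} (f : S → SphereSix) : S → ℙ ℂ (EuclideanSpace ℂ (Fin 7)) :=
  fun p => Projectivization.mk ℂ (complexify (f p)) (complexify_ne_zero (f p))

/-- An almost complex curve in the nearly Kähler `S⁶`: a smooth map whose differential is complex
linear, where the almost complex structure of `T_x S⁶ ⊆ ℝ⁷` is `w ↦ x × w`. -/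
structure IsAlmostComplexCurve {S : Type*} [TopologicalSpace S] [ChartedSpace ℂ S]
    (f : S → SphereSix) : Prop where
  smooth : ContMDiff 𝓘(ℝ, ℂ) (𝓡 6) ∞ f
  complex_linear : ∀ (p : S) (v : ℂ),
    mfderiv 𝓘(ℝ, ℂ) 𝓘(ℝ, EuclideanSpace ℝ (Fin 7))
        (fun q => (f q : EuclideanSpace ℝ (Fin 7))) p (Complex.I * v : ℂ) =
      cross (f p : EuclideanSpace ℝ (Fin 7))
        (mfderiv 𝓘(ℝ, ℂ) 𝓘(ℝ, EuclideanSpace ℝ (Fin 7))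
          (fun q => (f q : EuclideanSpace ℝ (Fin 7))) p v)

/-! ### Maps from a Riemann surface to a complex projective space -/

section HarmonicSequences

variable {V : Type*} [NormedAddCommGroup V] [InnerProductSpace ℂ V] [FiniteDimensional ℂ V]

/-- `∂g/∂z = (∂g/∂x - i ∂g/∂y) / 2`. -/
def dz (g : ℂ → V) (z : ℂ) : V :=
  (1 / 2 : ℂ) • (fderiv ℝ g z 1 - Complex.I • fderiv ℝ g z Complex.I)

/-- `∂g/∂z̄ = (∂g/∂x + i ∂g/∂y) / 2`. -/
def dzbar (g : ℂ → V) (z : ℂ) : V :=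
  (1 / 2 : ℂ) • (fderiv ℝ g z 1 + Complex.I • fderiv ℝ g z Complex.I)

variable {S : Type*} [TopologicalSpace S] [ChartedSpace ℂ S]

/-- `e` is a local complex coordinate of the Riemann surface `S`. -/
def IsCoordinate (e : OpenPartialHomeomorph S ℂ) : Prop :=
  e ∈ IsManifold.maximalAtlas 𝓘(ℂ) ω S

/-- `s` is a smooth section, over the open set `U` of the coordinate domain, of the line bundle
`L ⊆ S × V` whose fibre at `p` is the line `ψ p`. -/
structure IsSmoothSection (ψ : S → ℙ ℂ V) (e : OpenPartialHomeomorph S ℂ) (U : Set ℂ)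
    (s : ℂ → V) : Prop where
  coord : IsCoordinate e
  isOpen : IsOpen U
  subset : U ⊆ e.target
  smooth : ContDiffOn ℝ ∞ s U
  mem : ∀ z ∈ U, s z ∈ (ψ (e.symm z)).submodule

/-- `ψ` is smooth: around every point it has a smooth nowhere vanishing local lift. -/
def IsSmoothMap (ψ : S → ℙ ℂ V) : Prop :=
  ∀ p : S, ∃ (e : OpenPartialHomeomorph S ℂ) (U : Set ℂ) (s : ℂ → V),
    IsSmoothSection ψ e U s ∧ p ∈ e.source ∧ e p ∈ U ∧ ∀ z ∈ U, s z ≠ 0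

/-- Orthogonal projection on the fibre `L = ψ p`. -/
def projL (ψ : S → ℙ ℂ V) (p : S) (v : V) : V := (ψ p).submodule.starProjection v

/-- Orthogonal projection on the fibre of `L^⊥`. -/
def projPerp (ψ : S → ℙ ℂ V) (p : S) (v : V) : V := (ψ p).submoduleᗮ.starProjection v

/-- The bundle map `∂ : L → L^⊥`, `s ↦ (∂s/∂z)^{L^⊥}`. -/
def del (ψ : S → ℙ ℂ V) (e : OpenPartialHomeomorph S ℂ) (s : ℂ → V) (z : ℂ) : V :=
  projPerp ψ (e.symm z) (dz s z)

/-- The bundle map `∂̄ : L → L^⊥`, `s ↦ (∂s/∂z̄)^{L^⊥}`. -/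
def delbar (ψ : S → ℙ ℂ V) (e : OpenPartialHomeomorph S ℂ) (s : ℂ → V) (z : ℂ) : V :=
  projPerp ψ (e.symm z) (dzbar s z)

/-- The connection of `L` in the direction `∂/∂z̄`, `s ↦ (∂s/∂z̄)^L`; a section is holomorphic
when this vanishes. -/
def nablaBar (ψ : S → ℙ ℂ V) (e : OpenPartialHomeomorph S ℂ) (s : ℂ → V) (z : ℂ) : V :=
  projL ψ (e.symm z) (dzbar s z)

/-- `ψ` is a harmonic map: `(∇_{∂/∂z̄} dψ)(∂/∂z) = 0`. Here `dψ(∂/∂z)` is the section `∂` of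
`Hom(L, L^⊥) = ψ^* T ℂPⁿ`, which carries the connection induced from those of `L` and `L^⊥`,
and the equation is evaluated on all smooth local sections `s` of `L`. -/
def IsHarmonicMap (ψ : S → ℙ ℂ V) : Prop :=
  IsSmoothMap ψ ∧
  ∀ (e : OpenPartialHomeomorph S ℂ) (U : Set ℂ) (s : ℂ → V), IsSmoothSection ψ e U s →
    ∀ z ∈ U, projPerp ψ (e.symm z) (dzbar (del ψ e s) z) = del ψ e (nablaBar ψ e s) z

/-- `φ` is the next element `∂ψ` of the harmonic sequence of `ψ`: the zeros of the bundle map `∂`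
are isolated, and `φ` is the smooth map with `φ = [∂s]` off these zeros. -/
structure IsDelTransform (ψ φ : S → ℙ ℂ V) : Prop where
  smooth : IsSmoothMap φ
  mem : ∀ (e : OpenPartialHomeomorph S ℂ) (U : Set ℂ) (s : ℂ → V), IsSmoothSection ψ e U s →
    ∀ z ∈ U, del ψ e s z ∈ (φ (e.symm z)).submodule
  isolated_zeros : ∀ (e : OpenPartialHomeomorph S ℂ) (U : Set ℂ) (s : ℂ → V),
    IsSmoothSection ψ e U s → (∀ z ∈ U, s z ≠ 0) →
    ∀ᶠ z in Filter.codiscreteWithin U, del ψ e s z ≠ 0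

/-- `φ` is the previous element `∂̄ψ` of the harmonic sequence of `ψ`. -/
structure IsDelbarTransform (ψ φ : S → ℙ ℂ V) : Prop where
  smooth : IsSmoothMap φ
  mem : ∀ (e : OpenPartialHomeomorph S ℂ) (U : Set ℂ) (s : ℂ → V), IsSmoothSection ψ e U s →
    ∀ z ∈ U, delbar ψ e s z ∈ (φ (e.symm z)).submodule
  isolated_zeros : ∀ (e : OpenPartialHomeomorph S ℂ) (U : Set ℂ) (s : ℂ → V),
    IsSmoothSection ψ e U s → (∀ z ∈ U, s z ≠ 0) →
    ∀ᶠ z in Filter.codiscreteWithin U, delbar ψ e s z ≠ 0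

/-- `(ψ₀, …, ψₙ)` is a harmonic sequence that terminates at both ends: it starts at its holomorphic
element `ψ₀` (`∂̄ = 0`) and ends at its antiholomorphic element `ψₙ` (`∂ = 0`). -/
structure IsHarmonicSequence {n : ℕ} (ψ : Fin (n + 1) → S → ℙ ℂ V) : Prop where
  harmonic : ∀ j, IsHarmonicMap (ψ j)
  next : ∀ j : Fin n, IsDelTransform (ψ j.castSucc) (ψ j.succ)
  prev : ∀ j : Fin n, IsDelbarTransform (ψ j.succ) (ψ j.castSucc)
  first : ∀ (e : OpenPartialHomeomorph S ℂ) (U : Set ℂ) (s : ℂ → V),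
    IsSmoothSection (ψ 0) e U s → ∀ z ∈ U, delbar (ψ 0) e s z = 0
  last : ∀ (e : OpenPartialHomeomorph S ℂ) (U : Set ℂ) (s : ℂ → V),
    IsSmoothSection (ψ (Fin.last n)) e U s → ∀ z ∈ U, del (ψ (Fin.last n)) e s z = 0

/-- `φ` is superminimal: its harmonic sequence terminates. -/
def IsSuperminimal (φ : S → ℙ ℂ V) : Prop :=
  ∃ (n : ℕ) (ψ : Fin (n + 1) → S → ℙ ℂ V) (m : Fin (n + 1)), IsHarmonicSequence ψ ∧ ψ m = φ

/-- `φ` is linearly full: its image lies in no proper projective subspace. -/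
def IsLinearlyFull (φ : S → ℙ ℂ V) : Prop :=
  ∀ W : Submodule ℂ V, (∀ p, (φ p).submodule ≤ W) → W = ⊤

/-- `s` is a meromorphic section, not identically zero, of the holomorphic line bundle `L` of `ψ`
over the domain of the coordinate `e`: near each `z₀` it is `(z - z₀)^k g` for an integer `k` and
a nowhere vanishing holomorphic section `g`. -/
def IsMeromorphicSection (ψ : S → ℙ ℂ V) (e : OpenPartialHomeomorph S ℂ) (s : ℂ → V) : Prop :=
  ∀ z₀ ∈ e.target, ∃ (k : ℤ) (U : Set ℂ) (g : ℂ → V),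
    z₀ ∈ U ∧ IsSmoothSection ψ e U g ∧ (∀ z ∈ U, g z ≠ 0) ∧ (∀ z ∈ U, nablaBar ψ e g z = 0) ∧
    ∀ z ∈ U, z ≠ z₀ → s z = (z - z₀) ^ k • g z

/-- `f₀, …, fₙ` are meromorphic local sections of the harmonic sequence `ψ` in the coordinate `e`,
with `∂f_p/∂z = f_{p+1} + (⟨∂f_p/∂z, f_p⟩ / |f_p|²) f_p` and
`∂f_{p+1}/∂z̄ = -(|f_{p+1}|² / |f_p|²) f_p` as identities of meromorphic sections, that is, off a
discrete subset of the coordinate domain. (`inner ℂ` is conjugate linear in its first argument.) -/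
structure IsHarmonicFrame {n : ℕ} (ψ : Fin (n + 1) → S → ℙ ℂ V) (e : OpenPartialHomeomorph S ℂ)
    (f : Fin (n + 1) → ℂ → V) : Prop where
  meromorphic : ∀ j, IsMeromorphicSection (ψ j) e (f j)
  dz_eq : ∀ p : Fin n, ∀ᶠ z in Filter.codiscreteWithin e.target,
    dz (f p.castSucc) z = f p.succ z +
      (inner ℂ (f p.castSucc z) (dz (f p.castSucc) z) / (‖f p.castSucc z‖ : ℂ) ^ 2) •
        f p.castSucc z
  dzbar_eq : ∀ p : Fin n, ∀ᶠ z in Filter.codiscreteWithin e.target,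
    dzbar (f p.succ) z =
      -(((‖f p.succ z‖ : ℂ) ^ 2 / (‖f p.castSucc z‖ : ℂ) ^ 2) • f p.castSucc z)

end HarmonicSequences

/-- The multiplication table: the entry in row `i` and column `j` is the asserted value of
`f_i × f_j`. -/
def crossTable (f : Fin 7 → EuclideanSpace ℂ (Fin 7)) :
    Matrix (Fin 7) (Fin 7) (EuclideanSpace ℂ (Fin 7)) :=
  let i := Complex.I
  !![0,               0,          0,          -(i • f 0), -((2 * i) • f 1), -((2 * i) • f 2), -(i • f 3);
     0,               0,          i • f 0,    i • f 1,    0,                -(i • f 3),       -(i • f 4);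
     0,               -(i • f 0), 0,          i • f 2,    i • f 3,          0,                -(i • f 5);
     i • f 0,         -(i • f 1), -(i • f 2), 0,          i • f 4,          i • f 5,          -(i • f 6);
     (2 * i) • f 1,   0,          -(i • f 3), -(i • f 4), 0,                (2 * i) • f 6,    0;
     (2 * i) • f 2,   i • f 3,    0,          -(i • f 5), -((2 * i) • f 6), 0,                0;
     i • f 3,         i • f 4,    i • f 5,    i • f 6,    0,                0,                0]

end

/-! ### Algebra of the complex cross product -/

/-! Cross multiplication by `f` is skew for the complex bilinear dot product and squares to `-1` on
the complement of `f`, so `ℂ⁷` splits into `ℂ f` and two isotropic eigenspaces for `i` and `-i`,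
which conjugation exchanges. The table comes down to placing `F 4`, `F 5`, `F 6` in these
eigenspaces and computing `F 4 × F 5`; everything else is algebra.

The curve equation says `f × ∂f = i ∂f`, and `∂f = F 4` because this also makes `∂f` orthogonal to
`f`. Differentiating `f × F 4 = i F 4` gives the same relation for `F 5`. One more derivative gives
only `F 4 × F 5 = i F 6 - f × F 6`, and `cross_eq_neg_smul_of_cross_eq_sub` uses orthogonality and
isotropy of `F 6` to exclude a component for `i`. Hence `f × F 6 = -i F 6` and `F 4 × F 5 = 2i F 6`;
taking norms gives the last identity.

Since `f` is real, conjugation reverses the sequence: `F (3-k)` is `(-1)^k` times `conj (F (3+k))`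
divided by its squared norm (`eq_smul_conjVec_of_dzbar_eq`, `norm_sq_eq_inv`). This yields the rest
of the table.

That `f` is the middle of seven elements has two sources. The span of a terminating sequence is
parallel, so fullness forces as many elements as the dimension
(`IsHarmonicSequence.card_eq_finrank`). The reversal by conjugation then forces the self-conjugate
element to be in the middle (`IsHarmonicSequence.val_add_val_eq`). -/

section CrossProductAlgebra

/-- The `ℂ`-bilinear dot product of `ℂ⁷`. -/
noncomputable def dotC (x y : EuclideanSpace ℂ (Fin 7)) : ℂ := ∑ i, x i * y i

/-- Complex conjugation of `ℂ⁷`. -/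
noncomputable def conjVec : EuclideanSpace ℂ (Fin 7) ≃ₗᵢ[ℝ] EuclideanSpace ℂ (Fin 7) :=
  LinearIsometryEquiv.piLpCongrRight 2 (fun _ => Complex.conjLIE)

@[simp] theorem conjVec_apply (x : EuclideanSpace ℂ (Fin 7)) (i : Fin 7) :
    conjVec x i = (starRingEnd ℂ) (x i) := by
  simp [conjVec]

@[simp] theorem conjVec_conjVec (x : EuclideanSpace ℂ (Fin 7)) : conjVec (conjVec x) = x := by
  ext i; simp

theorem conjVec_smul (c : ℂ) (x : EuclideanSpace ℂ (Fin 7)) :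
    conjVec (c • x) = (starRingEnd ℂ) c • conjVec x := by
  ext i; simp

theorem inner_eq_dotC (x y : EuclideanSpace ℂ (Fin 7)) :
    inner ℂ x y = dotC (conjVec x) y := by
  simp [PiLp.inner_apply, dotC, mul_comm]

theorem dotC_conjVec_self (x : EuclideanSpace ℂ (Fin 7)) :
    dotC (conjVec x) x = (‖x‖ : ℂ) ^ 2 := by
  rw [← inner_eq_dotC, inner_self_eq_norm_sq_to_K]; rfl

theorem dotC_comm (x y : EuclideanSpace ℂ (Fin 7)) : dotC x y = dotC y x := by
  simp [dotC, mul_comm]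

theorem dotC_smul_right (c : ℂ) (x y : EuclideanSpace ℂ (Fin 7)) :
    dotC x (c • y) = c * dotC x y := by
  simp [dotC, Finset.mul_sum, mul_left_comm]

theorem dotC_smul_left (c : ℂ) (x y : EuclideanSpace ℂ (Fin 7)) :
    dotC (c • x) y = c * dotC x y := by
  rw [dotC_comm, dotC_smul_right, dotC_comm]

theorem dotC_add_right (x y z : EuclideanSpace ℂ (Fin 7)) :
    dotC x (y + z) = dotC x y + dotC x z := by
  simp [dotC, mul_add, Finset.sum_add_distrib]

theorem dotC_add_left (x y z : EuclideanSpace ℂ (Fin 7)) :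
    dotC (x + y) z = dotC x z + dotC y z := by
  rw [dotC_comm, dotC_add_right, dotC_comm, dotC_comm z y]

theorem dotC_conjVec (x y : EuclideanSpace ℂ (Fin 7)) :
    dotC (conjVec x) (conjVec y) = (starRingEnd ℂ) (dotC x y) := by
  simp [dotC]

theorem cross_swap {𝕜 : Type*} [RCLike 𝕜] (x y : EuclideanSpace 𝕜 (Fin 7)) :
    cross y x = -cross x y := by
  ext i; fin_cases i <;> simp [cross] <;> ring

theorem cross_self_eq_zero (x : EuclideanSpace ℂ (Fin 7)) : cross x x = 0 := by
  ext i; fin_cases i <;> simp [cross] <;> ring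

theorem cross_add_left (x y z : EuclideanSpace ℂ (Fin 7)) :
    cross (x + y) z = cross x z + cross y z := by
  ext i; fin_cases i <;> simp [cross] <;> ring

theorem cross_smul_left (c : ℂ) (x y : EuclideanSpace ℂ (Fin 7)) :
    cross (c • x) y = c • cross x y := by
  ext i; fin_cases i <;> simp [cross] <;> ring

theorem cross_add_right (x y z : EuclideanSpace ℂ (Fin 7)) :
    cross x (y + z) = cross x y + cross x z := by
  rw [cross_swap, cross_add_left, cross_swap x y, cross_swap x z, neg_add]; simp

theorem cross_smul_right (c : ℂ) (x y : EuclideanSpace ℂ (Fin 7)) :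
    cross x (c • y) = c • cross x y := by
  rw [cross_swap, cross_smul_left, cross_swap x y, smul_neg, neg_neg]

theorem conjVec_cross (x y : EuclideanSpace ℂ (Fin 7)) :
    conjVec (cross x y) = cross (conjVec x) (conjVec y) := by
  ext i; fin_cases i <;> simp [cross]

/-- The polarized form of `x × (x × y) = (x · y) x - (x · x) y`. -/
theorem cross_cross_add_cross_cross (x y z : EuclideanSpace ℂ (Fin 7)) :
    cross x (cross y z) + cross y (cross x z) =
      (-2 * dotC x y) • z + dotC x z • y + dotC y z • x := by
  ext i; fin_cases i <;> simp [cross, dotC, Fin.sum_univ_succ] <;> ring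

theorem dotC_cross (x y z : EuclideanSpace ℂ (Fin 7)) :
    dotC x (cross y z) = dotC (cross x y) z := by
  simp [cross, dotC, Fin.sum_univ_succ]; ring

variable {f A B : EuclideanSpace ℂ (Fin 7)} {c : ℂ}

/-- The triple product is alternating, so `f · (f × A) = (f × f) · A = 0`. -/
theorem dotC_eq_zero_of_cross_eq_smul (hc : c ≠ 0) (hA : cross f A = c • A) : dotC f A = 0 := by
  have h := dotC_cross f f A
  rw [hA, cross_self_eq_zero, dotC_smul_right] at h
  have h0 : dotC 0 A = 0 := by simp [dotC]
  rw [h0] at h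
  exact (mul_eq_zero.1 h).resolve_left hc

/-- Skewness of `f ×` gives `c (A · B) = -c (A · B)`: eigenspaces for nonzero eigenvalues are
isotropic. -/
theorem dotC_eq_zero_of_cross_eq_smul_of_cross_eq_smul (hc : c ≠ 0) (hA : cross f A = c • A)
    (hB : cross f B = c • B) : dotC A B = 0 := by
  have h := dotC_cross A f B
  rw [hB, cross_swap f A, hA, ← neg_smul, dotC_smul_right, dotC_smul_left] at h
  have : (2 * c) * dotC A B = 0 := by linear_combination h
  exact (mul_eq_zero.1 this).resolve_left (by simpa using hc)

/-- The polarized identity for `f, A, B` and for `f, B, A` expresses `f × (A × B)` in two ways;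
adding them cancels this term and leaves `-2i (A × B) = 2 (A · B) f`. -/
theorem cross_eq_smul_of_cross_eq_smul_of_cross_eq_neg_smul (hA : cross f A = Complex.I • A)
    (hB : cross f B = -(Complex.I • B)) : cross A B = (Complex.I * dotC A B) • f := by
  have hB' : cross f B = (-Complex.I) • B := by rw [hB, neg_smul]
  have hfA := dotC_eq_zero_of_cross_eq_smul Complex.I_ne_zero hA
  have hfB := dotC_eq_zero_of_cross_eq_smul (neg_ne_zero.2 Complex.I_ne_zero) hB'
  have h1 := cross_cross_add_cross_cross f A B
  have h2 := cross_cross_add_cross_cross f B A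
  rw [hB', cross_smul_right, hfA, hfB] at h1
  rw [hA, cross_smul_right, cross_swap A B, hfA, hfB, dotC_comm B A, ← neg_one_smul ℂ (cross A B),
    cross_smul_right] at h2
  have h3 : (2 * Complex.I) • cross A B = (-2 * dotC A B) • f := by
    linear_combination (norm := module) (-1 : ℂ) • h1 + (-1 : ℂ) • h2
  have h4 : (2 * Complex.I) • cross A B = (2 * Complex.I) • ((Complex.I * dotC A B) • f) := by
    rw [h3, smul_smul]; congr 1; linear_combination (-2 * dotC A B) * Complex.I_mul_I
  exact smul_right_injective _ (by simp) h4

theorem conjVec_cross_eq (hf : conjVec f = f) (hA : cross f A = Complex.I • A) :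
    cross f (conjVec A) = -(Complex.I • conjVec A) := by
  have := congrArg conjVec hA
  rw [conjVec_cross, hf, conjVec_smul] at this
  simpa using this

theorem conjVec_cross_eq' (hf : conjVec f = f) (hA : cross f A = -(Complex.I • A)) :
    cross f (conjVec A) = Complex.I • conjVec A := by
  have := congrArg conjVec hA
  rw [conjVec_cross, hf, map_neg, conjVec_smul] at this
  simpa using this

theorem cross_zero_right (x : EuclideanSpace ℂ (Fin 7)) : cross x 0 = 0 := by
  simpa using cross_smul_right 0 x 0

theorem dotC_conjVec_left_comm (x y : EuclideanSpace ℂ (Fin 7)) :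
    dotC (conjVec x) y = (starRingEnd ℂ) (dotC (conjVec y) x) := by
  rw [← dotC_conjVec, conjVec_conjVec, dotC_comm]

theorem norm_sq_ne_zero {x : EuclideanSpace ℂ (Fin 7)} (hx : x ≠ 0) : (‖x‖ : ℂ) ^ 2 ≠ 0 := by
  simpa using hx

theorem cross_cross_eq_zero {A B : EuclideanSpace ℂ (Fin 7)} (h : dotC A A = 0)
    (h' : dotC A B = 0) : cross A (cross A B) = 0 := by
  have h1 := cross_cross_add_cross_cross A A B
  rw [h, h'] at h1
  have : (2 : ℂ) • cross A (cross A B) = 0 := by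
    linear_combination (norm := module) h1
  simpa using this

variable {C : EuclideanSpace ℂ (Fin 7)}

/-- The product of an eigenvector `A` of `f ×` for `i` with the product of the conjugates. -/
theorem cross_conjVec_cross (hf : conjVec f = f)
    (hA : cross f A = Complex.I • A) (hB : cross f B = Complex.I • B)
    (hAB : dotC (conjVec A) B = 0) :
    cross (conjVec A) (cross A B) = (-2 * (‖A‖ : ℂ) ^ 2) • B := by
  have h0 : cross (conjVec A) B = 0 := by
    rw [cross_swap, cross_eq_smul_of_cross_eq_smul_of_cross_eq_neg_smul hB
      (conjVec_cross_eq hf hA), dotC_comm, hAB]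
    simp
  have h1 := cross_cross_add_cross_cross (conjVec A) A B
  rw [h0, cross_zero_right, dotC_conjVec_self, hAB,
    dotC_eq_zero_of_cross_eq_smul_of_cross_eq_smul Complex.I_ne_zero hA hB] at h1
  simpa using h1

/-- All dot products in the polarized identity vanish, so `f ×` and `A ×` anticommute when applied
to `B`. -/
theorem cross_cross_eq_neg_of_cross_eq (hA : cross f A = Complex.I • A)
    (hB : cross f B = Complex.I • B) : cross f (cross A B) = -(Complex.I • cross A B) := by
  have h1 := cross_cross_add_cross_cross f A B
  rw [hB, cross_smul_right, dotC_eq_zero_of_cross_eq_smul Complex.I_ne_zero hA,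
    dotC_eq_zero_of_cross_eq_smul Complex.I_ne_zero hB,
    dotC_eq_zero_of_cross_eq_smul_of_cross_eq_smul Complex.I_ne_zero hA hB] at h1
  linear_combination (norm := module) h1

/-- If `A` and `B` are orthogonal eigenvectors of `f ×` for `i` and `A × B` is the projection of
`2 i C`, with `C` isotropic and orthogonal to `f`, `A` and `B`, then `C` is an eigenvector
for `-i`. -/
theorem cross_eq_neg_smul_of_cross_eq_sub (hf : conjVec f = f) (hff : dotC f f = 1) (hA0 : A ≠ 0)
    (hB0 : B ≠ 0) (hA : cross f A = Complex.I • A) (hB : cross f B = Complex.I • B)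
    (hX : cross A B = Complex.I • C - cross f C) (hAB : dotC (conjVec A) B = 0)
    (hAC : dotC (conjVec A) C = 0) (hBC : dotC (conjVec B) C = 0) (hCC : dotC C C = 0)
    (hfC : dotC f C = 0) : cross f C = -(Complex.I • C) := by
  have hI := Complex.I_mul_I
  have hXA := cross_conjVec_cross hf hA hB hAB
  have hfX := cross_cross_eq_neg_of_cross_eq hA hB
  have hA' := conjVec_cross_eq hf hA
  have hB' := conjVec_cross_eq hf hB
  have hX0 : cross A B ≠ 0 := by
    intro h
    rw [h, cross_zero_right] at hXA
    simpa [hA0, hB0] using hXA.symm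
  set X := cross A B with hXdef
  -- Here `u` is twice the component of `C` for the eigenvalue `i`, while `X` lies in the eigenspace
  -- for `-i`; the aim is `u = 0`.
  set u := C - Complex.I • cross f C with hu
  have hffC : cross f (cross f C) = -C := by
    have h1 := cross_cross_add_cross_cross f f C
    rw [hff, hfC] at h1
    have : (2 : ℂ) • cross f (cross f C) = (2 : ℂ) • (-C) := by
      linear_combination (norm := module) h1
    exact smul_right_injective _ two_ne_zero this
  have hfu : cross f u = Complex.I • u := by
    rw [hu, sub_eq_add_neg, ← neg_smul, cross_add_right, cross_smul_right, hffC, smul_add,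
      smul_smul, mul_neg, hI]
    module
  have hC : C = (1 / 2 : ℂ) • u + (-Complex.I / 2) • X := by
    rw [hX, hu, smul_sub, smul_sub, smul_smul, smul_smul]
    have : -Complex.I / 2 * Complex.I = 1 / 2 := by linear_combination (-1 / 2 : ℂ) * hI
    rw [this]
    module
  have hiso : ∀ {c : ℂ} {P Q : EuclideanSpace ℂ (Fin 7)}, c ≠ 0 → cross f P = c • P →
    cross f Q = c • Q → dotC P Q = 0 :=
    fun hc h h' => dotC_eq_zero_of_cross_eq_smul_of_cross_eq_smul hc h h'
  have hnI : -Complex.I ≠ 0 := neg_ne_zero.2 Complex.I_ne_zero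
  rw [← neg_smul] at hfX hA' hB'
  have hu' : cross f (conjVec u) = (-Complex.I) • conjVec u := by
    rw [conjVec_cross_eq hf hfu, neg_smul]
  -- Both eigenspaces are isotropic, so only the mixed term of `C · C = 0` survives.
  have huX : dotC u X = 0 := by
    rw [hC] at hCC
    simp only [dotC_add_left, dotC_add_right, dotC_smul_left, dotC_smul_right,
      hiso Complex.I_ne_zero hfu hfu, hiso hnI hfX hfX, dotC_comm X u] at hCC
    have : Complex.I * dotC u X = 0 := by linear_combination -2 * hCC
    simpa using this
  have key : ∀ {P : EuclideanSpace ℂ (Fin 7)}, cross f (conjVec P) = (-Complex.I) • conjVec P →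
      dotC (conjVec P) C = 0 → dotC (conjVec u) P = 0 := by
    intro P hP hPC
    rw [hC, dotC_add_right, dotC_smul_right, dotC_smul_right, hiso hnI hP hfX] at hPC
    rw [dotC_conjVec_left_comm]
    simpa using hPC
  have huA := key hA' hAC
  have huB := key hB' hBC
  rw [neg_smul] at hu' hfX
  have h0 : cross (conjVec u) B = 0 := by
    rw [cross_swap, cross_eq_smul_of_cross_eq_smul_of_cross_eq_neg_smul hB hu', dotC_comm, huB]
    simp
  have h1 := cross_cross_add_cross_cross (conjVec u) A B
  rw [h0, cross_zero_right, huA, huB, hiso Complex.I_ne_zero hA hB, ← hXdef] at h1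
  have h1' : cross (conjVec u) X = 0 := by simpa using h1
  have h2 : cross u X = 0 := by
    rw [cross_eq_smul_of_cross_eq_smul_of_cross_eq_neg_smul hfu hfX, huX]
    simp
  -- Both `u` and its conjugate annihilate `X`, so the polarized identity reduces to `|u|² X = 0`,
  -- with `X ≠ 0`.
  have h3 := cross_cross_add_cross_cross (conjVec u) u X
  rw [← neg_smul] at hu' hfX
  rw [h1', h2, cross_zero_right, cross_zero_right, huX, hiso hnI hu' hfX, dotC_conjVec_self] at h3
  have hu0 : u = 0 := by
    by_contra hne
    have : (-2 * (‖u‖ : ℂ) ^ 2) • X = 0 := by simpa using h3.symm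
    rcases smul_eq_zero.1 this with h | h
    · simp [hne] at h
    · exact hX0 h
  have h4 : C = Complex.I • cross f C := sub_eq_zero.1 hu0
  calc cross f C = -((Complex.I * Complex.I) • cross f C) := by rw [hI]; module
    _ = -(Complex.I • C) := by rw [← smul_smul, ← h4]

/-- With `X = A × B`, pairing `conj A × X = -2|A|² B` with `conj B` and moving the cross product
across gives `|X|² = 2|A|²|B|²`, whereas `|X|² = 4|C|²`. -/
theorem norm_sq_mul_norm_sq_of_cross_eq (hf : conjVec f = f)
    (hA : cross f A = Complex.I • A) (hB : cross f B = Complex.I • B)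
    (hAB : dotC (conjVec A) B = 0) (hX : cross A B = (2 * Complex.I) • C) :
    (‖A‖ : ℂ) ^ 2 * (‖B‖ : ℂ) ^ 2 = 2 * (‖C‖ : ℂ) ^ 2 := by
  have hXA := cross_conjVec_cross hf hA hB hAB
  have h1 : dotC (conjVec (cross A B)) (cross A B) = 4 * (‖C‖ : ℂ) ^ 2 := by
    rw [hX, conjVec_smul, dotC_smul_left, dotC_smul_right, dotC_conjVec_self]
    simp only [map_mul, Complex.conj_I, map_ofNat]
    linear_combination (-4 * (‖C‖ : ℂ) ^ 2) * Complex.I_mul_I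
  have h2 := dotC_cross (conjVec B) (conjVec A) (cross A B)
  rw [hXA, dotC_smul_right, dotC_conjVec_self, cross_swap (conjVec A), ← conjVec_cross,
    ← neg_one_smul ℂ (conjVec _), dotC_smul_left, h1] at h2
  linear_combination (-1 / 2 : ℂ) * h2

end CrossProductAlgebra

/-! ### The multiplication table from the products of `F 3`, `F 4`, `F 5`, `F 6` -/

section CrossTable

theorem cross_eq_crossTable (F : Fin 7 → EuclideanSpace ℂ (Fin 7)) (hf : conjVec (F 3) = F 3)
    (hA0 : F 4 ≠ 0) (hB0 : F 5 ≠ 0) (hC0 : F 6 ≠ 0)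
    (t34 : cross (F 3) (F 4) = Complex.I • F 4) (t35 : cross (F 3) (F 5) = Complex.I • F 5)
    (t36 : cross (F 3) (F 6) = -(Complex.I • F 6))
    (t45 : cross (F 4) (F 5) = (2 * Complex.I) • F 6) (hAB : dotC (conjVec (F 4)) (F 5) = 0)
    (h0 : F 0 = -(((‖F 6‖ : ℂ) ^ 2)⁻¹ • conjVec (F 6)))
    (h1 : F 1 = ((‖F 5‖ : ℂ) ^ 2)⁻¹ • conjVec (F 5))
    (h2 : F 2 = -(((‖F 4‖ : ℂ) ^ 2)⁻¹ • conjVec (F 4))) (i j : Fin 7) :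
    cross (F i) (F j) = crossTable F i j := by
  have hI := Complex.I_mul_I
  have hI0 := Complex.I_ne_zero
  have habc := norm_sq_mul_norm_sq_of_cross_eq hf t34 t35 hAB t45
  have hXA := cross_conjVec_cross hf t34 t35 hAB
  have hBA : dotC (conjVec (F 5)) (F 4) = 0 := by rw [dotC_conjVec_left_comm, hAB, map_zero]
  have hXB := cross_conjVec_cross hf t35 t34 hBA
  rw [t45, cross_smul_right] at hXA
  rw [cross_swap (F 4), t45, ← neg_smul, cross_smul_right] at hXB
  have hA' := conjVec_cross_eq hf t34
  have hB' := conjVec_cross_eq hf t35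
  have hC' := conjVec_cross_eq' hf t36
  have hiso {P Q} (h : cross (F 3) P = Complex.I • P) (h' : cross (F 3) Q = Complex.I • Q) :=
    dotC_eq_zero_of_cross_eq_smul_of_cross_eq_smul hI0 h h'
  have t46 : cross (F 4) (F 6) = 0 := by
    have h := cross_cross_eq_zero (hiso t34 t34) (hiso t34 t35)
    rw [t45, cross_smul_right] at h
    simpa using h
  have t56 : cross (F 5) (F 6) = 0 := by
    have h := cross_cross_eq_zero (hiso t35 t35) (hiso t35 t34)
    rw [cross_swap (F 4), t45, ← neg_smul, cross_smul_right] at h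
    simpa using h
  have hmix {P Q} (h : cross (F 3) P = Complex.I • P) (h' : cross (F 3) Q = -(Complex.I • Q)) :=
    cross_eq_smul_of_cross_eq_smul_of_cross_eq_neg_smul h h'
  have ha := norm_sq_ne_zero hA0
  have hb := norm_sq_ne_zero hB0
  have hc := norm_sq_ne_zero hC0
  have mAA := hmix t34 hA'
  have mBB := hmix t35 hB'
  have mAB := hmix t34 hB'
  have mBA := hmix t35 hA'
  have mCC := hmix hC' t36
  rw [dotC_comm, dotC_conjVec_self] at mAA mBB
  rw [dotC_conjVec_self] at mCC
  rw [dotC_comm, hBA] at mAB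
  rw [dotC_comm, hAB] at mBA
  -- Contracting `F 4 × F 5 = 2i F 6` with the conjugate of one factor recovers the other;
  -- conjugates of these relations handle products with `F 0`.
  have eAC : cross (conjVec (F 4)) (F 6) = (Complex.I * (‖F 4‖ : ℂ) ^ 2) • F 5 := by
    refine smul_right_injective _ (mul_ne_zero two_ne_zero hI0) ?_
    simp only [hXA, smul_smul]
    congr 1
    linear_combination (-2 * (‖F 4‖ : ℂ) ^ 2) * hI
  have eBC : cross (conjVec (F 5)) (F 6) = (-Complex.I * (‖F 5‖ : ℂ) ^ 2) • F 4 := by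
    refine smul_right_injective _ (neg_ne_zero.2 (mul_ne_zero two_ne_zero hI0)) ?_
    simp only [hXB, smul_smul]
    congr 1
    linear_combination (-2 * (‖F 5‖ : ℂ) ^ 2) * hI
  have cAC := congrArg conjVec eAC
  have cBC := congrArg conjVec eBC
  have c45 := congrArg conjVec t45
  have c46 := congrArg conjVec t46
  have c56 := congrArg conjVec t56
  simp only [conjVec_cross, conjVec_conjVec, conjVec_smul, map_zero, map_mul, map_neg,
    Complex.conj_I, map_pow, Complex.conj_ofReal, map_ofNat] at cAC cBC c45 c46 c56
  generalize (‖F 4‖ : ℂ) ^ 2 = a at *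
  generalize (‖F 5‖ : ℂ) ^ 2 = b at *
  generalize (‖F 6‖ : ℂ) ^ 2 = c at *
  -- Eliminating `|F 6|²` leaves coefficients that are rational in the independent quantities `a`
  -- and `b`.
  have hc' : c = a * b / 2 := by linear_combination (-1 / 2 : ℂ) * habc
  subst hc'
  rw [← neg_smul] at h0 h2
  have t01 : cross (F 0) (F 1) = 0 := by
    rw [h0, h1, cross_smul_left, cross_smul_right, cross_swap, c56]; simp
  have t02 : cross (F 0) (F 2) = 0 := by
    rw [h0, h2, cross_smul_left, cross_smul_right, cross_swap, c46]; simp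
  have t03 : cross (F 0) (F 3) = -(Complex.I • F 0) := by
    rw [h0, cross_smul_left, cross_swap, hC']; module
  have t04 : cross (F 0) (F 4) = -((2 * Complex.I) • F 1) := by
    rw [h0, h1, cross_smul_left, cross_swap, cAC, ← neg_smul, ← neg_smul, smul_smul, smul_smul]
    congr 1; field_simp
  have t05 : cross (F 0) (F 5) = -((2 * Complex.I) • F 2) := by
    rw [h0, h2, cross_smul_left, cross_swap, cBC, ← neg_smul, ← neg_smul, smul_smul, smul_smul]
    congr 1; field_simp
  have t06 : cross (F 0) (F 6) = -(Complex.I • F 3) := by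
    rw [h0, cross_smul_left, mCC, smul_smul, ← neg_smul]
    congr 1; field_simp
  have t12 : cross (F 1) (F 2) = Complex.I • F 0 := by
    rw [h0, h1, h2, cross_smul_left, cross_smul_right, cross_swap, c45, ← neg_smul, smul_smul,
      smul_smul, smul_smul]
    congr 1; field_simp
  have t13 : cross (F 1) (F 3) = Complex.I • F 1 := by
    rw [h1, cross_smul_left, cross_swap, hB']; module
  have t14 : cross (F 1) (F 4) = 0 := by
    rw [h1, cross_smul_left, cross_swap, mAB]; simp
  have t15 : cross (F 1) (F 5) = -(Complex.I • F 3) := by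
    rw [h1, cross_smul_left, cross_swap, mBB, ← neg_smul, ← neg_smul, smul_smul]
    congr 1; field_simp
  have t16 : cross (F 1) (F 6) = -(Complex.I • F 4) := by
    rw [h1, cross_smul_left, eBC, ← neg_smul, smul_smul]
    congr 1; field_simp
  have t23 : cross (F 2) (F 3) = Complex.I • F 2 := by
    rw [h2, cross_smul_left, cross_swap, hA']; module
  have t24 : cross (F 2) (F 4) = Complex.I • F 3 := by
    rw [h2, cross_smul_left, cross_swap, mAA, ← neg_smul, smul_smul]
    congr 1; field_simp
  have t25 : cross (F 2) (F 5) = 0 := by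
    rw [h2, cross_smul_left, cross_swap, mBA]; simp
  have t26 : cross (F 2) (F 6) = -(Complex.I • F 5) := by
    rw [h2, cross_smul_left, eAC, ← neg_smul, smul_smul]
    congr 1; field_simp
  have swap {k l : Fin 7} {v w} (h : cross (F k) (F l) = v) (hv : -v = w) :
      cross (F l) (F k) = w := by rw [cross_swap, h, hv]
  have s (k : Fin 7) := cross_self_eq_zero (F k)
  fin_cases i <;> fin_cases j
  exacts [s 0, t01, t02, t03, t04, t05, t06,
    swap t01 neg_zero, s 1, t12, t13, t14, t15, t16,
    swap t02 neg_zero, swap t12 rfl, s 2, t23, t24, t25, t26,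
    swap t03 (neg_neg _), swap t13 rfl, swap t23 rfl, s 3, t34, t35, t36,
    swap t04 (neg_neg _), swap t14 neg_zero, swap t24 rfl, swap t34 rfl, s 4, t45, t46,
    swap t05 (neg_neg _), swap t15 (neg_neg _), swap t25 neg_zero, swap t35 rfl, swap t45 rfl,
    s 5, t56,
    swap t06 (neg_neg _), swap t16 (neg_neg _), swap t26 (neg_neg _), swap t36 (neg_neg _),
    swap t46 neg_zero, swap t56 neg_zero, s 6]

end CrossTable

/-! ### Wirtinger calculus for vector-valued maps -/

section WirtingerDerivatives

open Filter Topology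

variable {V : Type*} [NormedAddCommGroup V] [InnerProductSpace ℂ V]

theorem fderiv_eq_dz_add_dzbar (g : ℂ → V) (z ξ : ℂ) :
    fderiv ℝ g z ξ = ξ • dz g z + (starRingEnd ℂ) ξ • dzbar g z := by
  have hξ : ξ = ξ.re • (1 : ℂ) + ξ.im • Complex.I := by
    simp [Complex.re_add_im]
  have h1 : fderiv ℝ g z ξ = (ξ.re : ℂ) • fderiv ℝ g z 1 + (ξ.im : ℂ) • fderiv ℝ g z Complex.I := by
    conv_lhs => rw [hξ, map_add, map_smul, map_smul]
    simp
  have h2 : ξ = ξ.re + ξ.im * Complex.I := (Complex.re_add_im ξ).symm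
  have h3 : (starRingEnd ℂ) ξ = ξ.re - ξ.im * Complex.I := by
    conv_lhs => rw [h2]
    simp only [map_add, map_mul, Complex.conj_ofReal, Complex.conj_I]
    ring
  rw [h1, h3, dz, dzbar]
  nth_rewrite 3 [h2]
  simp only [smul_add, smul_sub, smul_smul]
  have : (Complex.I : ℂ) ^ 2 = -1 := Complex.I_sq
  match_scalars <;> (ring_nf; try simp [this])

theorem Filter.EventuallyEq.dz_eq {g h : ℂ → V} {z : ℂ} (hgh : g =ᶠ[𝓝 z] h) :
    dz g z = dz h z := by
  rw [dz, dz, hgh.fderiv_eq]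

theorem Filter.EventuallyEq.dzbar_eq {g h : ℂ → V} {z : ℂ} (hgh : g =ᶠ[𝓝 z] h) :
    dzbar g z = dzbar h z := by
  rw [dzbar, dzbar, hgh.fderiv_eq]

/-- The Hermitian product is conjugate linear in its first slot here, so applying `∂/∂z` to it puts
`∂/∂z̄` on `a`. -/
theorem inner_dzbar_add_inner_dz {a b : ℂ → V} {z c : ℂ} (ha : DifferentiableAt ℝ a z)
    (hb : DifferentiableAt ℝ b z) (h : ∀ᶠ w in 𝓝 z, inner ℂ (a w) (b w) = c) :
    inner ℂ (dzbar a z) (b z) + inner ℂ (a z) (dz b z) = 0 := by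
  have h0 : fderiv ℝ (fun w => inner ℂ (a w) (b w)) z = 0 := by
    have : (fun w => inner ℂ (a w) (b w)) =ᶠ[𝓝 z] fun _ => c := h
    rw [this.fderiv_eq]; simp
  have h1 := fderiv_inner_apply ℂ ha hb 1
  have h2 := fderiv_inner_apply ℂ ha hb Complex.I
  rw [h0] at h1 h2
  simp only [dz, dzbar, inner_add_left, inner_sub_right, inner_smul_left, inner_smul_right]
  simp only [zero_apply] at h1 h2
  simp only [map_div₀, map_one, map_ofNat, Complex.conj_I]
  linear_combination (-1 / 2 : ℂ) * h1 + (Complex.I / 2) * h2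

theorem exists_dzbar_smul_eq {r : ℂ → ℂ} {g : ℂ → V} {z : ℂ} (hr : DifferentiableAt ℝ r z)
    (hg : DifferentiableAt ℝ g z) :
    ∃ c : ℂ, dzbar (fun w => r w • g w) z = c • g z + r z • dzbar g z := by
  refine ⟨dzbar r z, ?_⟩
  have h : fderiv ℝ (fun w => r w • g w) z = _ := fderiv_smul hr hg
  rw [dzbar, h, dzbar, dzbar]
  simp only [add_apply, smul_apply, ContinuousLinearMap.smulRight_apply,
    smul_eq_mul]
  module

theorem dzbar_conjVec (g : ℂ → EuclideanSpace ℂ (Fin 7)) (z : ℂ) :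
    dzbar (fun w => conjVec (g w)) z = conjVec (dz g z) := by
  have h : fderiv ℝ (fun w => conjVec (g w)) z = _ := conjVec.comp_fderiv (f := g) (x := z)
  rw [dzbar, h, dz, conjVec_smul, map_sub, conjVec_smul]
  simp [Complex.conj_ofNat]

/-- The cross product of `ℂ⁷` as a bilinear map over the reals. -/
noncomputable def crossLinear : EuclideanSpace ℂ (Fin 7) →ₗ[ℝ] EuclideanSpace ℂ (Fin 7) →ₗ[ℝ]
    EuclideanSpace ℂ (Fin 7) :=
  LinearMap.mk₂ ℝ cross cross_add_left
    (fun c x y => by simpa using cross_smul_left (c : ℂ) x y) cross_add_right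
    (fun c x y => by simpa using cross_smul_right (c : ℂ) x y)

theorem dz_cross {a b : ℂ → EuclideanSpace ℂ (Fin 7)} {z : ℂ} (ha : DifferentiableAt ℝ a z)
    (hb : DifferentiableAt ℝ b z) :
    dz (fun w => cross (a w) (b w)) z = cross (dz a z) (b z) + cross (a z) (dz b z) := by
  have h : fderiv ℝ (fun w => cross (a w) (b w)) z = _ :=
    crossLinear.toContinuousBilinearMap.fderiv_of_bilinear ha hb
  have h' (ξ : ℂ) : fderiv ℝ (fun w => cross (a w) (b w)) z ξ =
      cross (a z) (fderiv ℝ b z ξ) + cross (fderiv ℝ a z ξ) (b z) := by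
    rw [h]; rfl
  rw [dz, h', h', dz, dz, cross_smul_left, cross_smul_right, sub_eq_add_neg (fderiv ℝ a z 1),
    sub_eq_add_neg (fderiv ℝ b z 1), cross_add_left, cross_add_right, ← neg_smul, ← neg_smul,
    cross_smul_left, cross_smul_right]
  module

theorem dz_const_smul (c : ℂ) {g : ℂ → V} {z : ℂ} (hg : DifferentiableAt ℝ g z) :
    dz (fun w => c • g w) z = c • dz g z := by
  have h : fderiv ℝ (fun w => c • g w) z = _ := fderiv_const_smul hg c
  rw [dz, h, dz]
  simp only [smul_apply]
  module

end WirtingerDerivatives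

/-! ### Projections onto the fibres of a line bundle -/

section LineBundles

open Filter Topology

variable {V : Type*} [NormedAddCommGroup V] [InnerProductSpace ℂ V]

theorem Projectivization.submodule_eq_span_singleton {L : ℙ ℂ V} {s : V} (hs : s ∈ L.submodule)
    (h0 : s ≠ 0) : L.submodule = ℂ ∙ s := by
  symm
  apply Submodule.eq_of_le_of_finrank_eq
  · simpa using hs
  · rw [finrank_span_singleton h0, L.finrank_submodule]

theorem exists_eq_smul_of_mem_submodule {L : ℙ ℂ V} {s t : V} (hs : s ∈ L.submodule) (h0 : s ≠ 0)
    (ht : t ∈ L.submodule) : ∃ c : ℂ, t = c • s := by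
  rw [Projectivization.submodule_eq_span_singleton hs h0] at ht
  obtain ⟨c, hc⟩ := Submodule.mem_span_singleton.1 ht
  exact ⟨c, hc.symm⟩

variable {S : Type*} {ψ : S → ℙ ℂ V} {p : S} {s : V}

theorem projL_eq (hs : s ∈ (ψ p).submodule) (h0 : s ≠ 0) (v : V) :
    projL ψ p v = (inner ℂ s v / (‖s‖ : ℂ) ^ 2) • s := by
  rw [projL]
  refine Submodule.eq_starProjection_of_mem_of_inner_eq_zero (Submodule.smul_mem _ _ hs)
    fun w hw => ?_
  obtain ⟨c, rfl⟩ := exists_eq_smul_of_mem_submodule hs h0 hw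
  have h1 : (‖s‖ : ℂ) ^ 2 ≠ 0 := by simpa using h0
  have h2 : inner ℂ s s = (‖s‖ : ℂ) ^ 2 := inner_self_eq_norm_sq_to_K s
  rw [inner_smul_right, inner_sub_left, inner_smul_left, map_div₀, inner_conj_symm, map_pow,
    Complex.conj_ofReal, h2, div_mul_cancel₀ _ h1, sub_self, mul_zero]

theorem projPerp_eq_sub (ψ : S → ℙ ℂ V) (p : S) (v : V) :
    projPerp ψ p v = v - projL ψ p v := by
  rw [projPerp, Submodule.starProjection_orthogonal_val, projL]

theorem projL_mem (ψ : S → ℙ ℂ V) (p : S) (v : V) : projL ψ p v ∈ (ψ p).submodule :=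
  Submodule.starProjection_apply_mem _ v

theorem inner_projPerp (hs : s ∈ (ψ p).submodule) (v : V) : inner ℂ s (projPerp ψ p v) = 0 :=
  (Submodule.mem_orthogonal _ _).1 (Submodule.starProjection_apply_mem _ v) s hs

end LineBundles

/-! ### Orthogonality of the elements of a terminating harmonic sequence -/

section HarmonicSequences

open Filter Topology

theorem eventually_codiscreteWithin_iff {X : Type*} [TopologicalSpace X] {U : Set X}
    (hU : IsOpen U) {P : X → Prop} :
    (∀ᶠ z in codiscreteWithin U, P z) ↔ ∀ z ∈ U, ∀ᶠ w in 𝓝[≠] z, P w := by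
  rw [Filter.Eventually, mem_codiscreteWithin_iff_forall_mem_nhdsNE]
  refine forall₂_congr fun z hz => ⟨fun h => ?_, fun h => ?_⟩
  · filter_upwards [h, mem_nhdsWithin_of_mem_nhds (hU.mem_nhds hz)] with w h1 h2
    exact h1.resolve_right fun h3 => h3 h2
  · filter_upwards [h] with w hw using Or.inl hw

/-- Identities off a discrete set hold near each point off such a set, and can therefore be
differentiated there. -/
theorem eventually_codiscreteWithin_eventually_nhds {X : Type*} [TopologicalSpace X] [T1Space X]
    {U : Set X} (hU : IsOpen U) {P : X → Prop} (h : ∀ᶠ z in codiscreteWithin U, P z) :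
    ∀ᶠ z in codiscreteWithin U, ∀ᶠ w in 𝓝 z, P w := by
  rw [eventually_codiscreteWithin_iff hU] at h ⊢
  intro z hz
  obtain ⟨O, hO, hzO, hP⟩ := mem_nhdsWithin.1 (h z hz)
  refine mem_nhdsWithin.2 ⟨O, hO, hzO, fun w hw => ?_⟩
  exact mem_of_superset ((hO.inter isOpen_compl_singleton).mem_nhds hw) hP

theorem contDiffOn_transition {S : Type*} [TopologicalSpace S] [ChartedSpace ℂ S]
    {e e' : OpenPartialHomeomorph S ℂ} (he : IsCoordinate e) (he' : IsCoordinate e') :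
    ContDiffOn ℂ ω (e.symm.trans e') (e.symm.trans e').source := by
  have h := (IsManifold.compatible_of_mem_maximalAtlas he he')
  have := (mem_groupoid_of_pregroupoid.1 h).1
  simpa [contDiffPregroupoid] using this

variable {V : Type*} [NormedAddCommGroup V] [InnerProductSpace ℂ V]

/-- Induction on the larger index: apply `∂/∂z` to `⟨s i, s p⟩ = 0`. Since `∂̄ (s i)` involves only
`s i` and its predecessor, its pairing with `s p` vanishes, and what remains is a nonzero multiple
of `⟨s i, s (p+1)⟩`. -/
theorem inner_eq_zero_of_frame {n : ℕ} {U : Set ℂ} (hU : IsOpen U) (s : Fin (n + 1) → ℂ → V)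
    (hd : ∀ j, ∀ z ∈ U, DifferentiableAt ℝ (s j) z)
    (hadj : ∀ p : Fin n, ∀ z ∈ U, inner ℂ (s p.castSucc z) (s p.succ z) = 0)
    (hdz : ∀ p : Fin n, ∀ z ∈ U, ∃ c a : ℂ, c ≠ 0 ∧
      dz (s p.castSucc) z = c • s p.succ z + a • s p.castSucc z)
    (hbar₀ : ∀ z ∈ U, ∃ b : ℂ, dzbar (s 0) z = b • s 0 z)
    (hbar : ∀ p : Fin n, ∀ z ∈ U, ∃ b b' : ℂ,
      dzbar (s p.succ) z = b • s p.castSucc z + b' • s p.succ z)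
    {i j : Fin (n + 1)} (hij : i < j) : ∀ z ∈ U, inner ℂ (s i z) (s j z) = 0 := by
  induction j using Fin.induction generalizing i with
  | zero => exact absurd hij (Fin.not_lt_zero i)
  | succ p ih =>
    intro z hz
    rcases (Fin.le_castSucc_iff.2 hij).eq_or_lt with rfl | hlt
    · exact hadj p z hz
    · have h0 := inner_dzbar_add_inner_dz (hd i z hz) (hd p.castSucc z hz)
        (mem_of_superset (hU.mem_nhds hz) (ih hlt))
      obtain ⟨c, a, hc, h1⟩ := hdz p z hz
      have h2 : inner ℂ (dzbar (s i) z) (s p.castSucc z) = 0 := by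
        cases i using Fin.cases with
        | zero =>
          obtain ⟨b, hb⟩ := hbar₀ z hz
          rw [hb, inner_smul_left, ih hlt z hz, mul_zero]
        | succ q =>
          obtain ⟨b, b', hb⟩ := hbar q z hz
          rw [hb, inner_add_left, inner_smul_left, inner_smul_left, ih hlt z hz,
            ih ((Fin.castSucc_lt_succ).trans hlt) z hz]
          simp
      rw [h1, h2, inner_add_right, inner_smul_right, inner_smul_right, ih hlt z hz] at h0
      simpa [hc] using h0

variable {S : Type*} [TopologicalSpace S] {ψ : S → ℙ ℂ V} {e : OpenPartialHomeomorph S ℂ}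
  {U : Set ℂ} {s : ℂ → V} {z : ℂ}

theorem exists_dz_eq_del_add (hs : s z ∈ (ψ (e.symm z)).submodule) (h0 : s z ≠ 0) :
    ∃ a : ℂ, dz s z = del ψ e s z + a • s z := by
  obtain ⟨a, ha⟩ := exists_eq_smul_of_mem_submodule hs h0 (projL_mem ψ (e.symm z) (dz s z))
  exact ⟨a, by rw [← ha, del, projPerp_eq_sub, sub_add_cancel]⟩

theorem exists_dzbar_eq_delbar_add (hs : s z ∈ (ψ (e.symm z)).submodule) (h0 : s z ≠ 0) :
    ∃ a : ℂ, dzbar s z = delbar ψ e s z + a • s z := by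
  obtain ⟨a, ha⟩ := exists_eq_smul_of_mem_submodule hs h0 (projL_mem ψ (e.symm z) (dzbar s z))
  exact ⟨a, by rw [← ha, delbar, projPerp_eq_sub, sub_add_cancel]⟩

variable [ChartedSpace ℂ S]

theorem IsSmoothSection.contDiffAt (hs : IsSmoothSection ψ e U s) (hz : z ∈ U) :
    ContDiffAt ℝ ∞ s z :=
  hs.smooth.contDiffAt (hs.isOpen.mem_nhds hz)

theorem IsSmoothSection.differentiableAt (hs : IsSmoothSection ψ e U s) (hz : z ∈ U) :
    DifferentiableAt ℝ s z :=
  (hs.contDiffAt hz).differentiableAt (by simp)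

theorem IsSmoothSection.mono (hs : IsSmoothSection ψ e U s) {U' : Set ℂ} (hU' : IsOpen U')
    (h : U' ⊆ U) : IsSmoothSection ψ e U' s :=
  ⟨hs.coord, hU', h.trans hs.subset, hs.smooth.mono h, fun z hz => hs.mem z (h hz)⟩

theorem IsSmoothMap.exists_isSmoothSection (hψ : IsSmoothMap ψ) (he : IsCoordinate e)
    (hz : z ∈ e.target) :
    ∃ (U : Set ℂ) (s : ℂ → V), IsSmoothSection ψ e U s ∧ z ∈ U ∧ ∀ w ∈ U, s w ≠ 0 := by
  obtain ⟨e', U', s', hs', hp, hpU, h0⟩ := hψ (e.symm z)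
  set τ := e.symm.trans e' with hτ
  have hsrc : ∀ w ∈ τ.source, w ∈ e.target ∧ e.symm w ∈ e'.source := fun w hw => by
    simpa [hτ] using hw
  refine ⟨τ.source ∩ τ ⁻¹' U', s' ∘ τ, ⟨he, τ.isOpen_inter_preimage hs'.isOpen, fun w hw =>
    (hsrc w hw.1).1, ?_, fun w hw => ?_⟩, ⟨by simp [hτ, hz, hp], hpU⟩, fun w hw => h0 _ hw.2⟩
  · have h1 : ContDiffOn ℝ ∞ τ τ.source :=
      ((contDiffOn_transition he hs'.coord).restrict_scalars ℝ).of_le le_top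
    exact hs'.smooth.comp (h1.mono Set.inter_subset_left) fun w hw => hw.2
  · have h1 := hs'.mem (τ w) hw.2
    have h2 : e'.symm (τ w) = e.symm w := e'.left_inv (hsrc w hw.1).2
    rwa [h2] at h1

theorem IsHarmonicSequence.inner_eq_zero {n : ℕ} {ψ : Fin (n + 1) → S → ℙ ℂ V}
    (hψ : IsHarmonicSequence ψ) {s : Fin (n + 1) → ℂ → V}
    (hs : ∀ j, IsSmoothSection (ψ j) e U (s j)) (h0 : ∀ j, ∀ z ∈ U, s j z ≠ 0)
    (hdel : ∀ p : Fin n, ∀ z ∈ U, del (ψ p.castSucc) e (s p.castSucc) z ≠ 0)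
    {i j : Fin (n + 1)} (hij : i ≠ j) : ∀ z ∈ U, inner ℂ (s i z) (s j z) = 0 := by
  have hmem := fun (p : Fin n) z (hz : z ∈ U) =>
    (hψ.next p).mem e U (s p.castSucc) (hs _) z hz
  have main : ∀ {i j : Fin (n + 1)}, i < j → ∀ z ∈ U, inner ℂ (s i z) (s j z) = 0 := by
    refine fun hij => inner_eq_zero_of_frame (hs 0).isOpen s
      (fun j z hz => (hs j).differentiableAt hz) ?_ ?_ ?_ ?_ hij
    · intro p z hz
      obtain ⟨c, hc⟩ := exists_eq_smul_of_mem_submodule (hmem p z hz) (hdel p z hz)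
        ((hs p.succ).mem z hz)
      rw [hc, inner_smul_right, del, inner_projPerp ((hs _).mem z hz), mul_zero]
    · intro p z hz
      obtain ⟨a, ha⟩ := exists_dz_eq_del_add ((hs p.castSucc).mem z hz) (h0 _ z hz)
      obtain ⟨c, hc⟩ := exists_eq_smul_of_mem_submodule ((hs p.succ).mem z hz) (h0 _ z hz)
        (hmem p z hz)
      refine ⟨c, a, ?_, by rw [ha, hc]⟩
      rintro rfl
      exact hdel p z hz (by rw [hc, zero_smul])
    · intro z hz
      obtain ⟨a, ha⟩ := exists_dzbar_eq_delbar_add ((hs 0).mem z hz) (h0 _ z hz)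
      exact ⟨a, by rw [ha, hψ.first e U _ (hs 0) z hz, zero_add]⟩
    · intro p z hz
      obtain ⟨a, ha⟩ := exists_dzbar_eq_delbar_add ((hs p.succ).mem z hz) (h0 _ z hz)
      obtain ⟨c, hc⟩ := exists_eq_smul_of_mem_submodule ((hs p.castSucc).mem z hz) (h0 _ z hz)
        ((hψ.prev p).mem e U _ (hs p.succ) z hz)
      exact ⟨c, a, by rw [ha, hc]⟩
  rcases hij.lt_or_gt with h | h
  · exact main h
  · intro z hz
    rw [← inner_conj_symm, main h z hz, map_zero]

/-- Nowhere vanishing local sections of all the line bundles of a harmonic sequence. -/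
theorem IsHarmonicSequence.exists_isSmoothSection {n : ℕ} {ψ : Fin (n + 1) → S → ℙ ℂ V}
    (hψ : IsHarmonicSequence ψ) (he : IsCoordinate e) (hz : z ∈ e.target) :
    ∃ (U : Set ℂ) (s : Fin (n + 1) → ℂ → V), z ∈ U ∧
      (∀ j, IsSmoothSection (ψ j) e U (s j)) ∧ (∀ j, ∀ w ∈ U, s j w ≠ 0) ∧
      ∀ i j, i ≠ j → ∀ w ∈ U, inner ℂ (s i w) (s j w) = 0 := by
  choose U s hs hzU h0 using fun j => (hψ.harmonic j).1.exists_isSmoothSection he hz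
  have hO : IsOpen (⋂ j, U j) := isOpen_iInter_of_finite fun j => (hs j).isOpen
  have hzO : z ∈ ⋂ j, U j := Set.mem_iInter.2 hzU
  have hsub := fun j => Set.iInter_subset U j
  have hs' := fun j => (hs j).mono hO (hsub j)
  have h0' := fun j w hw => h0 j w (hsub j hw)
  refine ⟨_, s, hzO, hs', h0', ?_⟩
  -- Orthogonality is known where no `∂` vanishes; it extends over the isolated zeros by continuity.
  have hself : ∀ᶠ w in codiscreteWithin (⋂ j, U j), w ∈ ⋂ j, U j :=
    Filter.self_mem_codiscreteWithin _
  have hcod : ∀ᶠ w in codiscreteWithin (⋂ j, U j), w ∈ ⋂ j, U j ∧ ∀ p : Fin n,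
      del (ψ p.castSucc) e (s p.castSucc) w ≠ 0 :=
    hself.and (eventually_all.2 fun p => (hψ.next p).isolated_zeros e _ _ (hs' p.castSucc) (h0' _))
  have horth := eventually_codiscreteWithin_eventually_nhds hO hcod
  rw [eventually_codiscreteWithin_iff hO] at horth
  intro i j hij w hw
  have hev : (fun v => inner ℂ (s i v) (s j v)) =ᶠ[𝓝[≠] w] fun _ => 0 := by
    filter_upwards [horth w hw] with v hv
    obtain ⟨W, hW, hWo, hvW⟩ := eventually_nhds_iff.1 hv
    exact hψ.inner_eq_zero (fun j => (hs' j).mono hWo fun x hx => (hW x hx).1)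
      (fun j x hx => h0' j x (hW x hx).1) (fun p x hx => (hW x hx).2 p) hij v hvW
  have hcont : ContinuousAt (fun v => inner ℂ (s i v) (s j v)) w :=
    ((hs' i).contDiffAt hw).continuousAt.inner ((hs' j).contDiffAt hw).continuousAt
  exact ((hcont.eventuallyEq_nhds_iff_eventuallyEq_nhdsNE continuousAt_const).1 hev).self_of_nhds

end HarmonicSequences

/-! ### Linear fullness determines the length of the sequence -/

section LinearlyFull

open Filter Topology

variable {V : Type*} [NormedAddCommGroup V] [InnerProductSpace ℂ V]
  {S : Type*} [TopologicalSpace S] [ChartedSpace ℂ S] {e : OpenPartialHomeomorph S ℂ} {U : Set ℂ}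
  {n : ℕ} {ψ : Fin (n + 1) → S → ℙ ℂ V} {s : Fin (n + 1) → ℂ → V} {z : ℂ}

/-- The span of a terminating harmonic sequence is parallel. -/
theorem IsHarmonicSequence.fderiv_mem_span (hψ : IsHarmonicSequence ψ)
    (hs : ∀ j, IsSmoothSection (ψ j) e U (s j)) (h0 : ∀ j, ∀ z ∈ U, s j z ≠ 0) (hz : z ∈ U)
    (j : Fin (n + 1)) (ξ : ℂ) :
    fderiv ℝ (s j) z ξ ∈ Submodule.span ℂ (Set.range fun j => s j z) := by
  have hmem := fun j => Submodule.subset_span (R := ℂ) (Set.mem_range_self (f := fun j => s j z) j)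
  rw [fderiv_eq_dz_add_dzbar]
  refine add_mem (Submodule.smul_mem _ _ ?_) (Submodule.smul_mem _ _ ?_)
  · obtain ⟨a, ha⟩ := exists_dz_eq_del_add ((hs j).mem z hz) (h0 j z hz)
    rw [ha]
    refine add_mem ?_ (Submodule.smul_mem _ _ (hmem j))
    cases j using Fin.lastCases with
    | last => rw [hψ.last e U _ (hs _) z hz]; exact zero_mem _
    | cast p =>
      obtain ⟨c, hc⟩ := exists_eq_smul_of_mem_submodule ((hs p.succ).mem z hz) (h0 _ z hz)
        ((hψ.next p).mem e U _ (hs p.castSucc) z hz)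
      rw [hc]
      exact Submodule.smul_mem _ _ (hmem _)
  · obtain ⟨a, ha⟩ := exists_dzbar_eq_delbar_add ((hs j).mem z hz) (h0 j z hz)
    rw [ha]
    refine add_mem ?_ (Submodule.smul_mem _ _ (hmem j))
    cases j using Fin.cases with
    | zero => rw [hψ.first e U _ (hs _) z hz]; exact zero_mem _
    | succ p =>
      obtain ⟨c, hc⟩ := exists_eq_smul_of_mem_submodule ((hs p.castSucc).mem z hz) (h0 _ z hz)
        ((hψ.prev p).mem e U _ (hs p.succ) z hz)
      rw [hc]
      exact Submodule.smul_mem _ _ (hmem _)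

/-- The sum `y` is the projection of `v` onto the span of the sequence. The span is parallel, so
`dy` lies in it; differentiating `⟨s i, y⟩ = ⟨s i, v⟩` shows that `dy` is also orthogonal to it. -/
theorem sum_projL_isLocallyConstant [IsManifold 𝓘(ℂ) ω S] (hψ : IsHarmonicSequence ψ) (v : V) :
    IsLocallyConstant fun p => ∑ j, projL (ψ j) p v := by
  rw [IsLocallyConstant.iff_eventually_eq]
  intro p
  have he : IsCoordinate (chartAt ℂ p) := IsManifold.chart_mem_maximalAtlas p
  generalize hchart : chartAt ℂ p = e at he
  have hpe : p ∈ e.source := by rw [← hchart]; exact mem_chart_source ℂ p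
  obtain ⟨U, s, hzU, hs, h0, horth⟩ := hψ.exists_isSmoothSection he (e.map_source hpe)
  set a : Fin (n + 1) → ℂ → ℂ := fun j w => inner ℂ (s j w) v / (‖s j w‖ : ℂ) ^ 2 with ha
  set y : ℂ → V := fun w => ∑ j, a j w • s j w with hy
  have hyQ : ∀ w ∈ U, ∑ j, projL (ψ j) (e.symm w) v = y w := fun w hw =>
    Finset.sum_congr rfl fun j _ => projL_eq ((hs j).mem w hw) (h0 j w hw) v
  have hsd := fun j w (hw : w ∈ U) => (hs j).differentiableAt hw
  have hself : ∀ x : V, inner ℂ x x = (‖x‖ : ℂ) ^ 2 := fun x => inner_self_eq_norm_sq_to_K x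
  have had : ∀ j, ∀ w ∈ U, DifferentiableAt ℝ (a j) w := fun j w hw => by
    have h1 := ((hsd j w hw).inner ℂ (differentiableAt_const v))
    have h2 := ((hsd j w hw).inner ℂ (hsd j w hw))
    simp only [hself] at h2
    have h3 : (‖s j w‖ : ℂ) ^ 2 ≠ 0 := by simpa using h0 j w hw
    simp only [ha, div_eq_mul_inv]
    exact h1.mul (h2.fun_inv h3)
  have hyd : ∀ w ∈ U, DifferentiableAt ℝ y w := fun w hw =>
    DifferentiableAt.fun_sum fun j _ => (had j w hw).smul (hsd j w hw)
  have hin : ∀ w ∈ U, ∀ i, inner ℂ (s i w) (y w) = inner ℂ (s i w) v := fun w hw i => by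
    rw [hy, inner_sum, Finset.sum_eq_single i]
    · have h1 : (‖s i w‖ : ℂ) ^ 2 ≠ 0 := by simpa using h0 i w hw
      rw [inner_smul_right, hself, ha, div_mul_cancel₀ _ h1]
    · intro j _ hj
      rw [inner_smul_right, horth i j hj.symm w hw, mul_zero]
    · simp
  have hspan : ∀ w ∈ U, ∀ x ∈ Submodule.span ℂ (Set.range fun j => s j w),
      inner ℂ x (y w) = inner ℂ x v := by
    intro w hw x hx
    induction hx using Submodule.span_induction with
    | mem x hx => obtain ⟨i, rfl⟩ := hx; exact hin w hw i
    | zero => simp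
    | add x x' _ _ h h' => rw [inner_add_left, inner_add_left, h, h']
    | smul c x _ h => rw [inner_smul_left, inner_smul_left, h]
  have hderiv : ∀ w ∈ U, fderiv ℝ y w = 0 := by
    intro w hw
    ext ξ
    have hW : fderiv ℝ y w ξ ∈ Submodule.span ℂ (Set.range fun j => s j w) := by
      have h2 : fderiv ℝ y w = ∑ j, fderiv ℝ (fun w => a j w • s j w) w :=
        fderiv_fun_sum fun j _ => (had j w hw).smul (hsd j w hw)
      rw [h2, sum_apply]
      refine Submodule.sum_mem _ fun j _ => ?_
      have h1 : fderiv ℝ (fun w => a j w • s j w) w = _ := fderiv_smul (had j w hw) (hsd j w hw)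
      rw [h1]
      exact add_mem (Submodule.smul_mem _ _ (hψ.fderiv_mem_span hs h0 hw j ξ))
        (Submodule.smul_mem _ _ (Submodule.subset_span ⟨j, rfl⟩))
    have hperp : ∀ x ∈ Submodule.span ℂ (Set.range fun j => s j w),
        inner ℂ x (fderiv ℝ y w ξ) = 0 := by
      intro x hx
      induction hx using Submodule.span_induction with
      | mem x hx =>
        obtain ⟨i, rfl⟩ := hx
        have hU := (hs i).isOpen.mem_nhds hw
        have h1 := fderiv_inner_apply ℂ (hsd i w hw) (hyd w hw) ξ
        have h2 := fderiv_inner_apply ℂ (hsd i w hw) (differentiableAt_const v) ξ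
        have h3 : (fun w => inner ℂ (s i w) (y w)) =ᶠ[𝓝 w] fun w => inner ℂ (s i w) v :=
          mem_of_superset hU fun w hw => hin w hw i
        rw [h3.fderiv_eq, h2, hspan w hw _ (hψ.fderiv_mem_span hs h0 hw i ξ)] at h1
        simpa using h1.symm
      | zero => simp
      | add x x' _ _ h h' => rw [inner_add_left, h, h', add_zero]
      | smul c x _ h => rw [inner_smul_left, h, mul_zero]
    simpa using hperp _ hW
  obtain ⟨r, hr, hB⟩ := Metric.isOpen_iff.1 (hs 0).isOpen _ hzU
  have hBy : ∀ w ∈ Metric.ball (e p) r, y w = y (e p) := fun w hw =>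
    Metric.isOpen_ball.is_const_of_fderiv_eq_zero (convex_ball _ _).isPreconnected
      (fun w hw => (hyd w (hB hw)).differentiableWithinAt) (fun w hw => hderiv w (hB hw)) hw
      (Metric.mem_ball_self hr)
  have hnhds : ∀ᶠ q in 𝓝 p, e q ∈ Metric.ball (e p) r :=
    (e.continuousAt hpe) (Metric.ball_mem_nhds _ hr)
  filter_upwards [hnhds, e.open_source.mem_nhds hpe] with q hq hqs
  have h1 := hyQ (e q) (hB hq)
  have h2 := hyQ (e p) hzU
  rw [e.left_inv hqs] at h1
  rw [e.left_inv hpe] at h2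
  rw [h1, h2, hBy _ hq]

/-- A terminating harmonic sequence with a linearly full element has `dim V` elements. -/
theorem IsHarmonicSequence.card_eq_finrank [FiniteDimensional ℂ V] [ConnectedSpace S]
    [IsManifold 𝓘(ℂ) ω S]
    (hψ : IsHarmonicSequence ψ) {m : Fin (n + 1)} (hm : IsLinearlyFull (ψ m)) :
    n + 1 = Module.finrank ℂ V := by
  have horth : ∀ p : S, ∀ i j, i ≠ j → ∀ x ∈ (ψ i p).submodule, ∀ y ∈ (ψ j p).submodule,
      inner ℂ x y = 0 := by
    intro p i j hij x hx y hy
    have he : IsCoordinate (chartAt ℂ p) := IsManifold.chart_mem_maximalAtlas p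
    have hpe := mem_chart_source ℂ p
    obtain ⟨U, s, hzU, hs, h0, horth⟩ :=
      hψ.exists_isSmoothSection he ((chartAt ℂ p).map_source hpe)
    have hmem := fun j => (hs j).mem _ hzU
    simp only [(chartAt ℂ p).left_inv hpe] at hmem
    obtain ⟨c, rfl⟩ := exists_eq_smul_of_mem_submodule (hmem i) (h0 i _ hzU) hx
    obtain ⟨d, rfl⟩ := exists_eq_smul_of_mem_submodule (hmem j) (h0 j _ hzU) hy
    rw [inner_smul_left, inner_smul_right, horth i j hij _ hzU, mul_zero, mul_zero]
  obtain ⟨p₀⟩ : Nonempty S := inferInstance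
  have hrep : ∀ j, (ψ j p₀).rep ∈ (ψ j p₀).submodule := fun j => by
    rw [Projectivization.submodule_eq]; exact Submodule.mem_span_singleton_self _
  have hrep0 : ∀ j, (ψ j p₀).rep ≠ 0 := fun j => (ψ j p₀).rep_nonzero
  have hli : LinearIndependent ℂ fun j => (ψ j p₀).rep :=
    linearIndependent_of_ne_zero_of_inner_eq_zero hrep0
      fun i j hij => horth p₀ i j hij _ (hrep i) _ (hrep j)
  -- The sum of the projections fixes the line `ψ m p` and is the same at `p` and `p₀`, so every
  -- such line lies in the span at `p₀`.
  have htop : Submodule.span ℂ (Set.range fun j => (ψ j p₀).rep) = ⊤ := by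
    refine hm _ fun p x hx => ?_
    have hx' : ∑ j, projL (ψ j) p x = x := by
      rw [Finset.sum_eq_single m]
      · exact Submodule.starProjection_eq_self_iff.2 hx
      · intro j _ hj
        exact (Submodule.starProjection_apply_eq_zero_iff _).2
          ((Submodule.mem_orthogonal _ _).2 fun u hu => horth p j m hj u hu x hx)
      · simp
    rw [← hx', (sum_projL_isLocallyConstant hψ x).apply_eq_of_isPreconnected isPreconnected_univ
      (Set.mem_univ p) (Set.mem_univ p₀)]
    refine Submodule.sum_mem _ fun j _ => ?_
    obtain ⟨c, hc⟩ := exists_eq_smul_of_mem_submodule (hrep j) (hrep0 j) (projL_mem (ψ j) p₀ x)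
    rw [hc]
    exact Submodule.smul_mem _ _ (Submodule.subset_span ⟨j, rfl⟩)
  have := finrank_span_eq_card hli
  rw [htop, finrank_top] at this
  rw [this, Fintype.card_fin]

end LinearlyFull

/-! ### Almost complex curves in a local coordinate -/

section AlmostComplexCurves

open Filter Topology

/-- The inclusion `ℝ⁷ ⊆ ℂ⁷` as a linear map. -/
noncomputable def complexifyL : EuclideanSpace ℝ (Fin 7) →L[ℝ] EuclideanSpace ℂ (Fin 7) :=
  LinearMap.toContinuousLinearMap
    { toFun := complexify
      map_add' := fun x y => by ext i; simp [complexify]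
      map_smul' := fun c x => by ext i; simp [complexify] }

theorem complexify_cross (x y : EuclideanSpace ℝ (Fin 7)) :
    complexify (cross x y) = cross (complexify x) (complexify y) := by
  ext i; fin_cases i <;> simp [cross, complexify]

theorem conjVec_complexify (x : EuclideanSpace ℝ (Fin 7)) :
    conjVec (complexify x) = complexify x := by
  ext i; simp [complexify]

theorem dotC_complexify_self (x : SphereSix) :
    dotC (complexify (x : EuclideanSpace ℝ (Fin 7))) (complexify x) = 1 := by
  have h1 : ‖(x : EuclideanSpace ℝ (Fin 7))‖ = 1 := by simp
  have h2 := EuclideanSpace.real_norm_sq_eq (x : EuclideanSpace ℝ (Fin 7))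
  rw [h1, one_pow] at h2
  simp only [dotC, complexify, ← sq]
  exact_mod_cast h2.symm

variable {S : Type*} [TopologicalSpace S] [ChartedSpace ℂ S] [IsManifold 𝓘(ℂ) ω S]
  {f : S → SphereSix} {e : OpenPartialHomeomorph S ℂ} {z : ℂ}

theorem IsAlmostComplexCurve.contDiffAt_and_fderiv_eq_cross (hf : IsAlmostComplexCurve f)
    (he : IsCoordinate e) (hz : z ∈ e.target) :
    ContDiffAt ℝ ∞ (fun w => (f (e.symm w) : EuclideanSpace ℝ (Fin 7))) z ∧
    fderiv ℝ (fun w => (f (e.symm w) : EuclideanSpace ℝ (Fin 7))) z Complex.I =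
      cross (f (e.symm z) : EuclideanSpace ℝ (Fin 7))
        (fderiv ℝ (fun w => (f (e.symm w) : EuclideanSpace ℝ (Fin 7))) z 1) := by
  set g : S → EuclideanSpace ℝ (Fin 7) := fun q => f q with hg
  set p := e.symm z with hp
  have hsm : ContMDiff 𝓘(ℝ, ℂ) 𝓘(ℝ, EuclideanSpace ℝ (Fin 7)) ∞ g :=
    contMDiff_coe_sphere.comp hf.smooth
  have hg1 : ContDiffAt ℝ ∞ (g ∘ (chartAt ℂ p).symm) (chartAt ℂ p p) := by
    have := (contMDiffAt_iff.1 (hsm p)).2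
    simp only [mfld_simps, contDiffWithinAt_univ] at this
    exact this
  have hmf : mfderiv 𝓘(ℝ, ℂ) 𝓘(ℝ, EuclideanSpace ℝ (Fin 7)) g p =
      fderiv ℝ (g ∘ (chartAt ℂ p).symm) (chartAt ℂ p p) := by
    have h1 := ((hsm p).mdifferentiableAt (by simp)).mfderiv
    simp only [mfld_simps, fderivWithin_univ, writtenInExtChartAt] at h1
    exact h1
  have hcl := hf.complex_linear p
  rw [hmf] at hcl
  have hχ : IsCoordinate (chartAt ℂ p) := IsManifold.chart_mem_maximalAtlas p
  have hpχ := mem_chart_source ℂ p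
  set τ := e.symm.trans (chartAt ℂ p) with hτ
  have hzτ : z ∈ τ.source := by
    simp [hτ, hz, ← hp]
  have hτz : τ z = chartAt ℂ p p := rfl
  have hτd : ContDiffAt ℂ ω τ z :=
    (contDiffOn_transition he hχ).contDiffAt (τ.open_source.mem_nhds hzτ)
  have heq : (fun w => g (e.symm w)) =ᶠ[𝓝 z] (g ∘ (chartAt ℂ p).symm) ∘ τ := by
    filter_upwards [τ.open_source.mem_nhds hzτ] with w hw
    have hw' : e.symm w ∈ (chartAt ℂ p).source := by
      have : w ∈ e.target ∧ e.symm w ∈ (chartAt ℂ p).source := by simpa [hτ] using hw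
      exact this.2
    exact congrArg g ((chartAt ℂ p).left_inv hw').symm
  have hτr : ContDiffAt ℝ ∞ τ z := (hτd.restrict_scalars ℝ).of_le le_top
  have hτD : DifferentiableAt ℂ τ z := hτd.differentiableAt (by simp)
  rw [← hτz] at hg1 hcl
  refine ⟨(hg1.comp z hτr).congr_of_eventuallyEq heq, ?_⟩
  rw [heq.fderiv_eq, fderiv_comp z (hg1.differentiableAt (by simp))
    (hτD.restrictScalars ℝ)]
  -- The coordinate change is holomorphic, so the equation passes from the preferred chart at `p` to
  -- any coordinate.
  have h2 : fderiv ℝ τ z Complex.I = Complex.I * fderiv ℝ τ z 1 := by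
    rw [hτD.fderiv_restrictScalars ℝ]
    simp only [ContinuousLinearMap.coe_restrictScalars']
    simpa only [smul_eq_mul, mul_one] using (fderiv ℂ τ z).map_smul Complex.I 1
  rw [ContinuousLinearMap.comp_apply, ContinuousLinearMap.comp_apply, h2]
  exact hcl _

theorem IsAlmostComplexCurve.isSmoothSection (hf : IsAlmostComplexCurve f) (he : IsCoordinate e) :
    IsSmoothSection (projMap f) e e.target (fun w => complexify (f (e.symm w))) := by
  refine ⟨he, e.open_target, subset_rfl, fun z hz => ?_, fun z hz => ?_⟩
  · exact (complexifyL.contDiff.contDiffAt.comp z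
      (hf.contDiffAt_and_fderiv_eq_cross he hz).1).contDiffWithinAt
  · simp [projMap, Projectivization.submodule_mk, Submodule.mem_span_singleton_self]

/-- Besides `f × f_x = f_y`, the constant length of `f` gives `f ⟂ f_x` and hence `f × f_y = -f_x`.
-/
theorem IsAlmostComplexCurve.cross_dz (hf : IsAlmostComplexCurve f) (he : IsCoordinate e)
    (hz : z ∈ e.target) :
    cross (complexify (f (e.symm z))) (dz (fun w => complexify (f (e.symm w))) z) =
      Complex.I • dz (fun w => complexify (f (e.symm w))) z := by
  obtain ⟨h1, h2⟩ := hf.contDiffAt_and_fderiv_eq_cross he hz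
  set F : ℂ → EuclideanSpace ℂ (Fin 7) := fun w => complexify (f (e.symm w)) with hF
  have hfd : ∀ ξ, fderiv ℝ F z ξ = complexify
      (fderiv ℝ (fun w => (f (e.symm w) : EuclideanSpace ℝ (Fin 7))) z ξ) := by
    intro ξ
    have h3 : HasFDerivAt F _ z := complexifyL.hasFDerivAt.comp z
      (h1.differentiableAt (by simp)).hasFDerivAt
    rw [h3.fderiv]; rfl
  have hy : fderiv ℝ F z Complex.I = cross (F z) (fderiv ℝ F z 1) := by
    rw [hfd, hfd, h2, complexify_cross]
  have hFd : DifferentiableAt ℝ F z :=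
    ((hf.isSmoothSection he).contDiffAt hz).differentiableAt (by simp)
  have hFF : dotC (F z) (F z) = 1 := dotC_complexify_self _
  have h0 : dotC (F z) (fderiv ℝ F z 1) = 0 := by
    have h4 := fderiv_inner_apply ℂ hFd hFd 1
    have h5 : (fun w => inner ℂ (F w) (F w)) = fun _ => (1 : ℂ) := by
      funext w
      rw [inner_eq_dotC, conjVec_complexify, dotC_complexify_self]
    have hx : conjVec (F z) = F z := conjVec_complexify _
    have hu : conjVec (fderiv ℝ F z 1) = fderiv ℝ F z 1 := by rw [hfd, conjVec_complexify]
    rw [h5, inner_eq_dotC, inner_eq_dotC, hx, hu, dotC_comm (fderiv ℝ F z 1)] at h4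
    simpa using h4.symm
  have h6 := cross_cross_add_cross_cross (F z) (F z) (fderiv ℝ F z 1)
  rw [hFF, h0] at h6
  have h7 : cross (F z) (fderiv ℝ F z Complex.I) = -fderiv ℝ F z 1 := by
    refine smul_right_injective _ (two_ne_zero (α := ℂ)) ?_
    simp only [hy]
    linear_combination (norm := module) h6
  change cross (F z) (dz F z) = Complex.I • dz F z
  rw [dz, cross_smul_right, sub_eq_add_neg, cross_add_right, ← hy, ← neg_smul, cross_smul_right,
    h7]
  simp only [smul_add, smul_neg, smul_smul, neg_smul]
  match_scalars
  · linear_combination (1 / 2 : ℂ) * Complex.I_mul_I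
  · ring

theorem inner_conjVec (x y : EuclideanSpace ℂ (Fin 7)) :
    inner ℂ (conjVec x) (conjVec y) = (starRingEnd ℂ) (inner ℂ x y) := by
  rw [inner_eq_dotC, inner_eq_dotC, dotC_conjVec]

end AlmostComplexCurves

/-! ### Conjugation reverses the harmonic sequence -/

section Symmetry

open Filter Topology

section

variable {V : Type*} [NormedAddCommGroup V] [InnerProductSpace ℂ V]
  {S : Type*} [TopologicalSpace S] {e : OpenPartialHomeomorph S ℂ} {U : Set ℂ} {s : ℂ → V}
  {ψ : S → ℙ ℂ V} {z : ℂ}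

theorem del_eq (hs : s z ∈ (ψ (e.symm z)).submodule) (h0 : s z ≠ 0) :
    del ψ e s z = dz s z - (inner ℂ (s z) (dz s z) / (‖s z‖ : ℂ) ^ 2) • s z := by
  rw [del, projPerp_eq_sub, projL_eq hs h0]

theorem delbar_eq (hs : s z ∈ (ψ (e.symm z)).submodule) (h0 : s z ≠ 0) :
    delbar ψ e s z = dzbar s z - (inner ℂ (s z) (dzbar s z) / (‖s z‖ : ℂ) ^ 2) • s z := by
  rw [delbar, projPerp_eq_sub, projL_eq hs h0]

variable [ChartedSpace ℂ S]

theorem IsSmoothSection.contDiffAt_del (hs : IsSmoothSection ψ e U s) (h0 : ∀ z ∈ U, s z ≠ 0)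
    (hz : z ∈ U) : ContDiffAt ℝ ∞ (del ψ e s) z := by
  have h1 : ContDiffAt ℝ ∞ s z := hs.contDiffAt hz
  have h2 : ContDiffAt ℝ ∞ (fderiv ℝ s) z := h1.fderiv_right (by simp)
  have h3 : ContDiffAt ℝ ∞ (dz s) z :=
    ((h2.clm_apply contDiffAt_const).sub
      ((h2.clm_apply contDiffAt_const).const_smul Complex.I)).const_smul (1 / 2 : ℂ)
  have h4 : ContDiffAt ℝ ∞ (fun w => (‖s w‖ : ℂ) ^ 2) z := by
    have h5 : ContDiffAt ℝ ∞ (fun w => inner ℂ (s w) (s w)) z := h1.inner ℂ h1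
    have h6 : ∀ w, inner ℂ (s w) (s w) = (‖s w‖ : ℂ) ^ 2 := fun w => inner_self_eq_norm_sq_to_K _
    simpa only [h6] using h5
  have h7 : (‖s z‖ : ℂ) ^ 2 ≠ 0 := by simpa using h0 z hz
  have h8 : ContDiffAt ℝ ∞ (fun w => dz s w -
      (inner ℂ (s w) (dz s w) * ((‖s w‖ : ℂ) ^ 2)⁻¹) • s w) z :=
    h3.sub (((h1.inner ℂ h3).mul (h4.inv h7)).smul h1)
  refine h8.congr_of_eventuallyEq ?_
  filter_upwards [hs.isOpen.mem_nhds hz] with w hw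
  rw [del_eq (hs.mem w hw) (h0 w hw), div_eq_mul_inv]

end

variable {S : Type*} [TopologicalSpace S]

theorem delbar_conjVec {ψ φ : S → ℙ ℂ (EuclideanSpace ℂ (Fin 7))}
    {e : OpenPartialHomeomorph S ℂ} {s : ℂ → EuclideanSpace ℂ (Fin 7)} {z : ℂ}
    (hs : s z ∈ (ψ (e.symm z)).submodule) (hs' : conjVec (s z) ∈ (φ (e.symm z)).submodule)
    (h0 : s z ≠ 0) : delbar φ e (fun w => conjVec (s w)) z = conjVec (del ψ e s z) := by
  rw [del_eq hs h0, delbar_eq hs' (by simpa using h0), dzbar_conjVec, inner_conjVec, map_sub,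
    conjVec_smul, LinearIsometryEquiv.norm_map, map_div₀, map_pow, Complex.conj_ofReal]

variable [ChartedSpace ℂ S]

/-- A terminating harmonic sequence with two elements which are conjugate to each other is
symmetric. -/
theorem IsHarmonicSequence.val_add_val_eq {n : ℕ}
    {ψ : Fin (n + 1) → S → ℙ ℂ (EuclideanSpace ℂ (Fin 7))} (hψ : IsHarmonicSequence ψ)
    {e : OpenPartialHomeomorph S ℂ} {U : Set ℂ} {s : ℂ → EuclideanSpace ℂ (Fin 7)}
    (hU : U.Nonempty) {a b : Fin (n + 1)} (ha : IsSmoothSection (ψ a) e U s)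
    (hb : IsSmoothSection (ψ b) e U (fun z => conjVec (s z))) (h0 : ∀ z ∈ U, s z ≠ 0) :
    a.val + b.val = n := by
  have ex : ∀ {U : Set ℂ} {P : ℂ → Prop}, IsOpen U → U.Nonempty →
      (∀ᶠ z in codiscreteWithin U, P z) → ∃ z ∈ U, P z := by
    intro U P hU ⟨z, hz⟩ h
    obtain ⟨w, h1, h2⟩ := (((eventually_codiscreteWithin_iff hU).1 h z hz).and
      (mem_nhdsWithin_of_mem_nhds (hU.mem_nhds hz))).exists
    exact ⟨w, h2, h1⟩
  -- Conjugation turns `∂` into `∂̄`, so `∂s` and its conjugate are sections for `a + 1` and `b -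
  -- 1`; the descent can stop only at both ends at once.
  induction b using Fin.induction generalizing a U s with
  | zero =>
    cases a using Fin.lastCases with
    | last => simp
    | cast p =>
      exfalso
      obtain ⟨z, hz, h⟩ := ex ha.isOpen hU ((hψ.next p).isolated_zeros e U s ha h0)
      have h1 := hψ.first e U _ hb z hz
      rw [delbar_conjVec (ha.mem z hz) (hb.mem z hz) (h0 z hz)] at h1
      exact h (by simpa using h1)
  | succ q ih =>
    have hdel : ∀ z ∈ U, delbar (ψ q.succ) e (fun z => conjVec (s z)) z = _ := fun z hz =>
      delbar_conjVec (ha.mem z hz) (hb.mem z hz) (h0 z hz)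
    obtain ⟨z, hz, h⟩ := ex ha.isOpen hU ((hψ.prev q).isolated_zeros e U _ hb
      (fun z hz => by simpa using h0 z hz))
    rw [hdel z hz] at h
    cases a using Fin.lastCases with
    | last => exact absurd (by rw [hψ.last e U _ ha z hz, map_zero]) h
    | cast p =>
      have hsm : ContDiffOn ℝ ∞ (del (ψ p.castSucc) e s) U := fun z hz =>
        (ha.contDiffAt_del h0 hz).contDiffWithinAt
      have hO := hsm.continuousOn.isOpen_inter_preimage ha.isOpen
        (isOpen_compl_singleton (x := (0 : EuclideanSpace ℂ (Fin 7))))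
      have hsub : U ∩ del (ψ p.castSucc) e s ⁻¹' {0}ᶜ ⊆ U := Set.inter_subset_left
      have key := ih (a := p.succ) (s := del (ψ p.castSucc) e s)
        (U := U ∩ del (ψ p.castSucc) e s ⁻¹' {0}ᶜ) ⟨z, hz, by simpa using h⟩
        ⟨ha.coord, hO, hsub.trans ha.subset, hsm.mono hsub,
          fun w hw => (hψ.next p).mem e U s ha w hw.1⟩
        ⟨ha.coord, hO, hsub.trans ha.subset, conjVec.contDiff.comp_contDiffOn (hsm.mono hsub),
          fun w hw => by
            have := (hψ.prev q).mem e U _ hb w hw.1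
            rwa [hdel w hw.1] at this⟩
        (fun w hw => hw.2)
      simp only [Fin.val_succ, Fin.val_castSucc] at key ⊢
      omega

theorem IsAlmostComplexCurve.exists_isHarmonicSequence [ConnectedSpace S]
    -- Fullness gives seven elements; the real lift `f` is its own conjugate, so its index `m`
    -- satisfies `m + m = 6`.
    [IsManifold 𝓘(ℂ) ω S] {f : S → SphereSix} (hf : IsAlmostComplexCurve f)
    (hfull : IsLinearlyFull (projMap f)) (hmin : IsSuperminimal (projMap f)) :
    ∃ ψ : Fin 7 → S → ℙ ℂ (EuclideanSpace ℂ (Fin 7)),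
      IsHarmonicSequence ψ ∧ ψ 3 = projMap f := by
  obtain ⟨n, ψ, m, hψ, hm⟩ := hmin
  have hn := hψ.card_eq_finrank (m := m) (by rwa [hm])
  obtain rfl : n = 6 := by simpa using hn
  obtain ⟨p⟩ : Nonempty S := inferInstance
  have he : IsCoordinate (chartAt ℂ p) := IsManifold.chart_mem_maximalAtlas p
  have hs := hf.isSmoothSection he
  rw [← hm] at hs
  have hne : (chartAt ℂ p).target.Nonempty := ⟨chartAt ℂ p p, mem_chart_target ℂ p⟩
  have hsum := hψ.val_add_val_eq hne hs
    (by simpa only [conjVec_complexify] using hs) (fun z _ => complexify_ne_zero _)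
  obtain rfl : m = 3 := by ext; simp; omega
  exact ⟨ψ, hψ, hm⟩

end Symmetry

/-! ### Harmonic frames and the proof of the table -/

section HarmonicFrames

open Filter Topology

theorem IsMeromorphicSection.eventually {V : Type*} [NormedAddCommGroup V]
    [InnerProductSpace ℂ V] {S : Type*} [TopologicalSpace S] [ChartedSpace ℂ S]
    {ψ : S → ℙ ℂ V} {e : OpenPartialHomeomorph S ℂ} {s : ℂ → V}
    (hs : IsMeromorphicSection ψ e s) :
    ∀ᶠ z in codiscreteWithin e.target,
      ContDiffAt ℝ ∞ s z ∧ s z ≠ 0 ∧ s z ∈ (ψ (e.symm z)).submodule := by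
  rw [eventually_codiscreteWithin_iff e.open_target]
  intro z₀ hz₀
  obtain ⟨k, U, g, hzU, hg, hg0, -, hsg⟩ := hs z₀ hz₀
  filter_upwards [self_mem_nhdsWithin, mem_nhdsWithin_of_mem_nhds (hg.isOpen.mem_nhds hzU)]
    with w hw hwU
  have hw0 : w - z₀ ≠ 0 := sub_ne_zero.2 hw
  refine ⟨?_, ?_, ?_⟩
  · have h1 : AnalyticAt ℂ (fun v => (v - z₀) ^ k) w :=
      (analyticAt_id.sub analyticAt_const).fun_zpow hw0
    have h2 : ContDiffAt ℝ ∞ (fun v => (v - z₀) ^ k) w := h1.contDiffAt.restrict_scalars ℝ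
    refine (h2.smul (hg.contDiffAt hwU)).congr_of_eventuallyEq ?_
    filter_upwards [hg.isOpen.mem_nhds hwU, isOpen_compl_singleton.mem_nhds hw] with v hvU hv
    exact hsg v hvU hv
  · rw [hsg w hwU hw]
    exact smul_ne_zero (zpow_ne_zero _ hw0) (hg0 w hwU)
  · rw [hsg w hwU hw]
    exact Submodule.smul_mem _ _ (hg.mem w hwU)

theorem differentiableAt_norm_sq {V : Type*} [NormedAddCommGroup V] [InnerProductSpace ℂ V]
    {s : ℂ → V} {z : ℂ} (hs : DifferentiableAt ℝ s z) :
    DifferentiableAt ℝ (fun w => (‖s w‖ : ℂ) ^ 2) z := by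
  have h : (fun w => (‖s w‖ : ℂ) ^ 2) = fun w => inner ℂ (s w) (s w) := by
    funext w
    exact (inner_self_eq_norm_sq_to_K (s w)).symm
  rw [h]
  exact hs.inner ℂ hs

/-- If two elements of a harmonic sequence are conjugate to each other, then so are the predecessor
of the one and the successor of the other. -/
theorem eq_smul_conjVec_of_dzbar_eq {A B : ℂ → EuclideanSpace ℂ (Fin 7)}
    {C D : EuclideanSpace ℂ (Fin 7)} {r : ℂ → ℂ} {z k a : ℂ}
    (hA : ∀ᶠ w in 𝓝 z, A w = r w • conjVec (B w)) (hr : DifferentiableAt ℝ r z)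
    (hB : DifferentiableAt ℝ B z) (hk : k ≠ 0) (hr0 : r z ≠ 0) (hB0 : B z ≠ 0)
    (hbar : dzbar A z = -(k • C)) (hdz : dz B z = D + a • B z) (hAC : inner ℂ (A z) C = 0)
    (hBD : inner ℂ (B z) D = 0) : C = -(r z / k) • conjVec D := by
  have hcB : DifferentiableAt ℝ (fun w => conjVec (B w)) z := by
    exact conjVec.differentiableAt.comp z hB
  obtain ⟨c, hc⟩ := exists_dzbar_smul_eq hr hcB
  have hA' : A =ᶠ[𝓝 z] fun w => r w • conjVec (B w) := hA
  rw [hA'.dzbar_eq, hc, dzbar_conjVec, hdz, map_add, conjVec_smul] at hbar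
  rw [hA.self_of_nhds, inner_smul_left] at hAC
  have hBC : inner ℂ (conjVec (B z)) C = 0 := (mul_eq_zero.1 hAC).resolve_left (by simpa using hr0)
  have hBB : inner ℂ (conjVec (B z)) (conjVec (B z)) ≠ 0 := by simpa using hB0
  -- Pairing with `conj B` kills `C` and `conj D`, so the total coefficient of `conj B` is zero and
  -- the unknown derivative of `r` disappears.
  have h1 := congrArg (inner ℂ (conjVec (B z))) hbar
  simp only [inner_add_right, inner_smul_right, inner_neg_right, hBC, inner_conjVec (B z) D, hBD,
    map_zero, mul_zero, neg_zero, zero_add] at h1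
  have h2 : c + r z * (starRingEnd ℂ) a = 0 :=
    (mul_eq_zero.1 (by linear_combination h1)).resolve_right hBB
  refine smul_right_injective _ hk ?_
  have h3 : k * -(r z / k) = -r z := by field_simp
  simp only [smul_smul, h3]
  linear_combination (norm := module) hbar - h2 • conjVec (B z)

/-- Taking norms gives `|x| = |x|² |y|`; this turns the factor `|F (3-k)|²` of the conjugation
relations into `|F (3+k)|⁻²`. -/
theorem norm_sq_eq_inv {x y : EuclideanSpace ℂ (Fin 7)} {c : ℂ} (hx : x ≠ 0)
    (hc : ‖c‖ = ‖x‖ ^ 2) (h : x = c • conjVec y) : (‖x‖ : ℂ) ^ 2 = ((‖y‖ : ℂ) ^ 2)⁻¹ := by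
  have h1 : ‖x‖ = ‖x‖ ^ 2 * ‖y‖ := by
    conv_lhs => rw [h, norm_smul, hc, LinearIsometryEquiv.norm_map]
  have h2 : ‖x‖ ≠ 0 := by simpa using hx
  have h3 : ‖x‖ * ‖y‖ = 1 := by
    refine mul_left_cancel₀ h2 ?_
    rw [mul_one]
    linear_combination -h1
  refine eq_inv_of_mul_eq_one_left ?_
  rw [← mul_pow]
  exact_mod_cast by rw [h3, one_pow]

variable {S : Type*} [TopologicalSpace S] [ChartedSpace ℂ S]

theorem IsHarmonicFrame.cross_eq_crossTable [IsManifold 𝓘(ℂ) ω S] {f : S → SphereSix}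
    (hf : IsAlmostComplexCurve f)
    {ψ : Fin 7 → S → ℙ ℂ (EuclideanSpace ℂ (Fin 7))} (hψ : IsHarmonicSequence ψ)
    {e : OpenPartialHomeomorph S ℂ} (he : IsCoordinate e)
    {F : Fin 7 → ℂ → EuclideanSpace ℂ (Fin 7)} (hF : IsHarmonicFrame ψ e F)
    (hF3 : ∀ z ∈ e.target, F 3 z = complexify (f (e.symm z))) :
    ∀ᶠ z in codiscreteWithin e.target,
      (∀ i j, cross (F i z) (F j z) = crossTable (fun k => F k z) i j) ∧
      ‖F 4 z‖ ^ 2 * ‖F 5 z‖ ^ 2 = 2 * ‖F 6 z‖ ^ 2 := by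
  have hself : ∀ᶠ z in codiscreteWithin e.target, z ∈ e.target :=
    Filter.self_mem_codiscreteWithin _
  have hgood := hself.and ((eventually_all.2 fun j => (hF.meromorphic j).eventually).and
    ((eventually_all.2 hF.dz_eq).and (eventually_all.2 hF.dzbar_eq)))
  filter_upwards [eventually_codiscreteWithin_eventually_nhds e.open_target hgood] with z hz
  -- On `U` the frame is smooth and nowhere zero and its equations hold everywhere, so they may be
  -- differentiated.
  obtain ⟨U, hgU, hU, hzU⟩ := eventually_nhds_iff.1 hz
  have hs : ∀ j, IsSmoothSection (ψ j) e U (F j) := fun j =>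
    ⟨he, hU, fun w hw => (hgU w hw).1,
      fun w hw => ((hgU w hw).2.1 j).1.contDiffWithinAt, fun w hw => ((hgU w hw).2.1 j).2.2⟩
  have h0 : ∀ j, ∀ w ∈ U, F j w ≠ 0 := fun j w hw => ((hgU w hw).2.1 j).2.1
  have hd : ∀ j, ∀ w ∈ U, DifferentiableAt ℝ (F j) w := fun j w hw => (hs j).differentiableAt hw
  have hdz : ∀ p : Fin 6, ∀ w ∈ U, ∃ a : ℂ,
      dz (F p.castSucc) w = F p.succ w + a • F p.castSucc w := fun p w hw =>
    ⟨_, (hgU w hw).2.2.1 p⟩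
  have hbar : ∀ p : Fin 6, ∀ w ∈ U, dzbar (F p.succ) w =
      -(((‖F p.succ w‖ : ℂ) ^ 2 / (‖F p.castSucc w‖ : ℂ) ^ 2) • F p.castSucc w) :=
    fun p w hw => (hgU w hw).2.2.2 p
  have hdel : ∀ p : Fin 6, ∀ w ∈ U, del (ψ p.castSucc) e (F p.castSucc) w ≠ 0 := by
    intro p w hw
    rw [del_eq ((hs _).mem w hw) (h0 _ w hw)]
    nth_rewrite 1 [(hgU w hw).2.2.1 p]
    rw [add_sub_cancel_right]
    exact h0 _ w hw
  have horth : ∀ i j, i ≠ j → ∀ w ∈ U, inner ℂ (F i w) (F j w) = 0 := fun i j hij =>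
    hψ.inner_eq_zero hs h0 hdel hij
  have hsq : ∀ j, ∀ w ∈ U, (‖F j w‖ : ℂ) ^ 2 ≠ 0 := fun j w hw => norm_sq_ne_zero (h0 j w hw)
  have hconj : ∀ w ∈ U, conjVec (F 3 w) = F 3 w := fun w hw => by
    rw [hF3 w (hgU w hw).1, conjVec_complexify]
  have hff : ∀ w ∈ U, dotC (F 3 w) (F 3 w) = 1 := fun w hw => by
    rw [hF3 w (hgU w hw).1, dotC_complexify_self]
  have hn3 : ∀ w ∈ U, (‖F 3 w‖ : ℂ) ^ 2 = 1 := fun w hw => by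
    rw [← dotC_conjVec_self, hconj w hw, hff w hw]
  have hnorm : ∀ (x : EuclideanSpace ℂ (Fin 7)), ‖(‖x‖ : ℂ) ^ 2‖ = ‖x‖ ^ 2 := fun x => by simp
  -- The recursion starts from the real section `F 3` with `r = 1`. Each step flips the sign, and
  -- the norms of the previous section cancel in `r / k`.
  have hF2 : ∀ w ∈ U, F 2 w = -((‖F 2 w‖ : ℂ) ^ 2) • conjVec (F 4 w) := by
    intro w hw
    obtain ⟨a, ha⟩ := hdz 3 w hw
    have h1 := eq_smul_conjVec_of_dzbar_eq (A := F 3) (B := F 3) (r := fun _ => 1)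
      (mem_of_superset (hU.mem_nhds hw) fun v hv => by simp [hconj v hv])
      (differentiableAt_const _) (hd 3 w hw) (div_ne_zero (hsq 3 w hw) (hsq 2 w hw)) one_ne_zero
      (h0 3 w hw) (hbar 2 w hw) ha (horth 3 2 (by decide) w hw) (horth 3 4 (by decide) w hw)
    rwa [hn3 w hw, one_div_one_div] at h1
  have hF1 : ∀ w ∈ U, F 1 w = ((‖F 1 w‖ : ℂ) ^ 2) • conjVec (F 5 w) := by
    intro w hw
    obtain ⟨a, ha⟩ := hdz 4 w hw
    have h1 := eq_smul_conjVec_of_dzbar_eq (A := F 2) (B := F 4)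
      (r := fun w => -((‖F 2 w‖ : ℂ) ^ 2))
      (mem_of_superset (hU.mem_nhds hw) hF2) (differentiableAt_norm_sq (hd 2 w hw)).neg
      (hd 4 w hw) (div_ne_zero (hsq 2 w hw) (hsq 1 w hw)) (neg_ne_zero.2 (hsq 2 w hw))
      (h0 4 w hw) (hbar 1 w hw) ha (horth 2 1 (by decide) w hw) (horth 4 5 (by decide) w hw)
    rwa [neg_div, neg_neg, div_div_cancel₀ (hsq 2 w hw)] at h1
  have hF0 : ∀ w ∈ U, F 0 w = -((‖F 0 w‖ : ℂ) ^ 2) • conjVec (F 6 w) := by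
    intro w hw
    obtain ⟨a, ha⟩ := hdz 5 w hw
    have h1 := eq_smul_conjVec_of_dzbar_eq (A := F 1) (B := F 5)
      (r := fun w => ((‖F 1 w‖ : ℂ) ^ 2))
      (mem_of_superset (hU.mem_nhds hw) hF1) (differentiableAt_norm_sq (hd 1 w hw))
      (hd 5 w hw) (div_ne_zero (hsq 1 w hw) (hsq 0 w hw)) (hsq 1 w hw)
      (h0 5 w hw) (hbar 0 w hw) ha (horth 1 0 (by decide) w hw) (horth 5 6 (by decide) w hw)
    rwa [div_div_cancel₀ (hsq 1 w hw)] at h1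
  have hcross : ∀ w ∈ U, cross (F 3 w) (dz (F 3) w) = Complex.I • dz (F 3) w := by
    intro w hw
    have heq : F 3 =ᶠ[𝓝 w] fun v => complexify (f (e.symm v)) :=
      mem_of_superset (hU.mem_nhds hw) fun v hv => hF3 v (hgU v hv).1
    rw [heq.dz_eq, hF3 w (hgU w hw).1]
    exact hf.cross_dz he (hgU w hw).1
  have hdz3 : ∀ w ∈ U, dz (F 3) w = F 4 w := by
    intro w hw
    have h2 := dotC_eq_zero_of_cross_eq_smul Complex.I_ne_zero (hcross w hw)
    obtain ⟨a, ha⟩ : ∃ a : ℂ, dz (F 3) w = F 4 w + a • F 3 w := hdz 3 w hw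
    have h3 := horth 3 4 (by decide) w hw
    rw [inner_eq_dotC, hconj w hw] at h3
    rw [ha, dotC_add_right, dotC_smul_right, h3, hff w hw, mul_one, zero_add] at h2
    rw [ha, h2, zero_smul, add_zero]
  have t34 : ∀ w ∈ U, cross (F 3 w) (F 4 w) = Complex.I • F 4 w := fun w hw => by
    rw [← hdz3 w hw, hcross w hw]
  -- This is `∂/∂z` of `f × F j = i F j`, with `∂f = F 4`.
  have step : ∀ j : Fin 7, (∀ w ∈ U, cross (F 3 w) (F j w) = Complex.I • F j w) → ∀ w ∈ U,
      cross (F 4 w) (F j w) + cross (F 3 w) (dz (F j) w) = Complex.I • dz (F j) w := by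
    intro j hj w hw
    have heq : (fun v => cross (F 3 v) (F j v)) =ᶠ[𝓝 w] fun v => Complex.I • F j v :=
      mem_of_superset (hU.mem_nhds hw) hj
    have h1 := heq.dz_eq
    rwa [dz_cross (hd 3 w hw) (hd j w hw), dz_const_smul _ (hd j w hw), hdz3 w hw] at h1
  have t35 : ∀ w ∈ U, cross (F 3 w) (F 5 w) = Complex.I • F 5 w := by
    intro w hw
    obtain ⟨a, ha⟩ : ∃ a : ℂ, dz (F 4) w = F 5 w + a • F 4 w := hdz 4 w hw
    have h1 := step 4 t34 w hw
    rw [cross_self_eq_zero, ha, cross_add_right, cross_smul_right, t34 w hw] at h1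
    linear_combination (norm := module) h1
  have t45 : cross (F 4 z) (F 5 z) = Complex.I • F 6 z - cross (F 3 z) (F 6 z) := by
    obtain ⟨a, ha⟩ : ∃ a : ℂ, dz (F 5) z = F 6 z + a • F 5 z := hdz 5 z hzU
    have h1 := step 5 t35 z hzU
    rw [ha, cross_add_right, cross_smul_right, t35 z hzU] at h1
    linear_combination (norm := module) h1
  have hdot : ∀ i j, i ≠ j → dotC (conjVec (F i z)) (F j z) = 0 := fun i j hij => by
    rw [← inner_eq_dotC, horth i j hij z hzU]
  -- `F 0` is a nonzero multiple of `conj (F 6)`, so Hermitian orthogonality of `F 0` and `F 6` is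
  -- isotropy of `F 6`.
  have hCC : dotC (F 6 z) (F 6 z) = 0 := by
    have h1 := hdot 0 6 (by decide)
    rw [hF0 z hzU, conjVec_smul, conjVec_conjVec, dotC_smul_left] at h1
    refine (mul_eq_zero.1 h1).resolve_left ?_
    simpa using h0 0 z hzU
  have hfC := hdot 3 6 (by decide)
  rw [hconj z hzU] at hfC
  have t36 := cross_eq_neg_smul_of_cross_eq_sub (hconj z hzU) (hff z hzU) (h0 4 z hzU) (h0 5 z hzU)
    (t34 z hzU) (t35 z hzU) t45 (hdot 4 5 (by decide)) (hdot 4 6 (by decide))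
    (hdot 5 6 (by decide)) hCC hfC
  have t45' : cross (F 4 z) (F 5 z) = (2 * Complex.I) • F 6 z := by
    rw [t45, t36]; module
  have hnF0 := norm_sq_eq_inv (h0 0 z hzU) (by rw [norm_neg, hnorm]) (hF0 z hzU)
  have hnF1 := norm_sq_eq_inv (h0 1 z hzU) (hnorm _) (hF1 z hzU)
  have hnF2 := norm_sq_eq_inv (h0 2 z hzU) (by rw [norm_neg, hnorm]) (hF2 z hzU)
  refine ⟨_root_.cross_eq_crossTable (fun k => F k z) (hconj z hzU) (h0 4 z hzU) (h0 5 z hzU)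
    (h0 6 z hzU) (t34 z hzU) (t35 z hzU) t36 t45' (hdot 4 5 (by decide)) ?_ ?_ ?_, ?_⟩
  · rw [← hnF0, ← neg_smul]; exact hF0 z hzU
  · rw [← hnF1]; exact hF1 z hzU
  · rw [← hnF2, ← neg_smul]; exact hF2 z hzU
  · exact_mod_cast norm_sq_mul_norm_sq_of_cross_eq (hconj z hzU) (t34 z hzU) (t35 z hzU)
      (hdot 4 5 (by decide)) t45'

end HarmonicFrames

theorem mainTheorem9 {S : Type*} [TopologicalSpace S] [T2Space S] [ConnectedSpace S]
    [ChartedSpace ℂ S] [IsManifold 𝓘(ℂ) ω S]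
    (f : S → SphereSix) (hf : IsAlmostComplexCurve f)
    (hfull : IsLinearlyFull (projMap f)) (hmin : IsSuperminimal (projMap f)) :
    (∃ ψ : Fin 7 → S → ℙ ℂ (EuclideanSpace ℂ (Fin 7)),
      IsHarmonicSequence ψ ∧ ψ 3 = projMap f) ∧
    ∀ ψ : Fin 7 → S → ℙ ℂ (EuclideanSpace ℂ (Fin 7)), IsHarmonicSequence ψ → ψ 3 = projMap f →
      ∀ (e : OpenPartialHomeomorph S ℂ), IsCoordinate e →
      ∀ F : Fin 7 → ℂ → EuclideanSpace ℂ (Fin 7), IsHarmonicFrame ψ e F →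
        (∀ z ∈ e.target, F 3 z = complexify (f (e.symm z))) →
        ∀ᶠ z in Filter.codiscreteWithin e.target,
          (∀ i j, cross (F i z) (F j z) = crossTable (fun k => F k z) i j) ∧
          ‖F 4 z‖ ^ 2 * ‖F 5 z‖ ^ 2 = 2 * ‖F 6 z‖ ^ 2 := ⟨hf.exists_isHarmonicSequence hfull hmin, fun _ hψ _ _ he _ hF hF3 =>
    hF.cross_eq_crossTable hf hψ he hF3⟩
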